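/- Let $\mathbb{H}$, $\mathbb{H}_\alpha$, $\Xi$ be complex Hilbert spaces, with $\mathbb{H}_\alpha$ continuously and densely embedded in $\mathbb{H}$. Let $A$ be the generator of a $C_0$-semigroup $G(t)$, $t\ge 0$, in $\mathbb{H}$ with $\mathcal{D}(A)\subset\mathbb{H}_\alpha$, and let $B\in\mathcal{L}(\Xi;\mathbb{H})$. For $v_0\in\mathbb{H}$ and a control $\xi$ that is $L_2$ with values in $\Xi$, let $$v(t)=v(t,v_0,\xi)=G(t)v_0+\int_0^t G(t-s)B\xi(s)\,ds$$ be the mild solution of $\dot v=Av+B\xi$, $v(0)=v_0$. Let $$\mathcal{F}(v,\xi)=(\mathcal{F}_1v,v)_\alpha+2\operatorname{Re}(\mathcal{F}_2v,\xi)_\Xi+(\mathcal{F}_3\xi,\xi)_\Xi ,\qquad v\in\mathbb{H}_\alpha,\ \xi\in\Xi,$$ where $\mathcal{F}_1=\mathcal{F}_1^*\in\mathcal{L}(\mathbb{H}_\alpha)$, $\mathcal{F}_2\in\mathcal{L}(\mathbb{H}_\alpha;\Xi)$, $\mathcal{F}_3=\mathcal{F}_3^*\in\mathcal{L}(\Xi)$.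 Put $\mathcal{Z}=L_2(0,+\infty;\mathbb{H}_\alpha)\times L_2(0,+\infty;\Xi)$. For $v_0\in\mathbb{H}_\alpha$ let $\mathfrak{M}_{v_0}$ be the set of all $(v(\cdot),\xi(\cdot))\in\mathcal{Z}$ with $v(\cdot)=v(\cdot,v_0,\xi)$ (the processes through $v_0$), and for $(v,\xi)\in\mathcal{Z}$ let $\mathcal{J}_\mathcal{F}(v,\xi)=\int_0^\infty\mathcal{F}(v(t),\xi(t))\,dt$. Define the following infima of quotients with nonzero denominators, with values in $[-\infty,+\infty]$ and $\inf\emptyset=+\infty$: $$\alpha_1=\inf_{(v,\xi)\in\mathfrak{M}_0}\frac{\mathcal{J}_\mathcal{F}(v,\xi)}{\|v\|^2_{L_2(0,+\infty;\mathbb{H}_\alpha)}+\|\xi\|^2_{L_2(0,+\infty;\Xi)}},\qquad \alpha_2=\inf\frac{\mathcal{F}(v,\xi)}{|v|_\alpha^2+|\xi|_\Xi^2},$$ where the second infimum is over all $\omega\in\mathbb{R}$, $v\in\mathcal{D}(A)$, $\xi\in\Xi$ with $i\omega v=Av+B\xi$; and $$\alpha_3=\inf_{\omega\in\mathbb{R}}\inf_{\xi\in\Xi}\frac{\mathcal{F}(-(A-i\omega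 I)^{-1}B\xi,\xi)}{|\xi|_\Xi^2},$$ which is called well-defined if $A$ has no spectrum on the imaginary axis and the operators $(A-i\omega I)^{-1}B$ are bounded in $\mathcal{L}(\Xi;\mathbb{H}_\alpha)$ uniformly in $\omega\in\mathbb{R}$. Assume (CONT): for every $v_0\in\mathbb{H}_\alpha$ there is $\xi\in L_2(0,+\infty;\Xi)$ such that $v(\cdot,v_0,\xi)\in L_2(0,+\infty;\mathbb{H}_\alpha)$. Then the following hold. 1) If $\alpha_1>0$, then for every $v_0\in\mathbb{H}_\alpha$ the functional $\mathcal{J}_\mathcal{F}$ has a unique minimum point $(v^0(\cdot,v_0),\xi^0(\cdot,v_0))$ on $\mathfrak{M}_{v_0}$, and the map $v_0\mapsto(v^0(\cdot,v_0),\xi^0(\cdot,v_0))$ is a bounded linear operator from $\mathbb{H}_\alpha$ to $\mathcal{Z}$. Moreover, there is a self-adjoint $P\in\mathcal{L}(\mathbb{H}_\alpha)$ such that $(Pv_0,v_0)_\alpha=\mathcal{J}_\mathcal{F}(v^0(\cdot,v_0),\xi^0(\cdot,v_0))$ for all $v_0\in\mathbb{H}_\alpha$, and, with $V(v):=(Pv,v)_\alpha$,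 $$V(v(T))-V(v_0)+\int_0^T\mathcal{F}(v(t),\xi(t))\,dt\ge 0$$ for all $T\ge0$, $v_0\in\mathbb{H}_\alpha$ and $\xi\in L_2(0,T;\Xi)$ such that $v(\cdot)=v(\cdot,v_0,\xi)\in C([0,T];\mathbb{H}_\alpha)$. 2) $\alpha_1>0$ if and only if $\alpha_2>0$. If $\alpha_3$ is well-defined, then $\alpha_2>0$ if and only if $\alpha_3>0$. -/

import Mathlib

open MeasureTheory Set Filter Topology

noncomputable section

namespace FreqThm

/-- A strongly continuous semigroup `G(t)`, `t ≥ 0`, of bounded operators in `H`. The index is a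
real number for convenience; the values of `toFun` at negative times carry no information and are
never used. -/
structure C0Semigroup (H : Type*) [NormedAddCommGroup H] [InnerProductSpace ℂ H] where
  toFun : ℝ → H →L[ℂ] H
  map_zero : toFun 0 = ContinuousLinearMap.id ℂ H
  map_add : ∀ s t : ℝ, 0 ≤ s → 0 ≤ t → toFun (s + t) = (toFun s).comp (toFun t)
  continuousOn : ∀ x : H, ContinuousOn (fun t => toFun t x) (Ici 0)

/-- `A` is the generator of the semigroup `G`: `x ∈ D(A)` and `A x = y` if and only if
`(G(t) x - x) / t → y` as `t → 0+`. -/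
def IsGenerator {H : Type*} [NormedAddCommGroup H] [InnerProductSpace ℂ H]
    (A : H →ₗ.[ℂ] H) (G : C0Semigroup H) : Prop :=
  ∀ x y : H, (∃ hx : x ∈ A.domain, A ⟨x, hx⟩ = y) ↔
    Tendsto (fun t : ℝ => ((t⁻¹ : ℝ) : ℂ) • (G.toFun t x - x)) (𝓝[>] (0 : ℝ)) (𝓝 y)

/-- `R` is the (bounded, everywhere defined) inverse `(A - z I)⁻¹` of `A - z I : D(A) → H`. -/
def IsResolventAt {H : Type*} [NormedAddCommGroup H] [InnerProductSpace ℂ H]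
    (A : H →ₗ.[ℂ] H) (z : ℂ) (R : H →L[ℂ] H) : Prop :=
  (∀ x : A.domain, R (A x - z • (x : H)) = x) ∧
    ∀ y : H, ∃ h : R y ∈ A.domain, A ⟨R y, h⟩ - z • R y = y

/-- The spectrum of the (unbounded) operator `A`. -/
def opSpectrum {H : Type*} [NormedAddCommGroup H] [InnerProductSpace ℂ H]
    (A : H →ₗ.[ℂ] H) : Set ℂ :=
  {z | ¬ ∃ R : H →L[ℂ] H, IsResolventAt A z R}

open Classical in
/-- The resolvent `(A - z I)⁻¹`; it is set to `0` for `z` in the spectrum of `A`. -/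
def opResolvent {H : Type*} [NormedAddCommGroup H] [InnerProductSpace ℂ H]
    (A : H →ₗ.[ℂ] H) (z : ℂ) : H →L[ℂ] H :=
  if h : ∃ R : H →L[ℂ] H, IsResolventAt A z R then h.choose else 0

variable {H Hα Ξ : Type*}
  [NormedAddCommGroup H] [InnerProductSpace ℂ H] [CompleteSpace H]
  [NormedAddCommGroup Hα] [InnerProductSpace ℂ Hα] [CompleteSpace Hα]
  [NormedAddCommGroup Ξ] [InnerProductSpace ℂ Ξ] [CompleteSpace Ξ]

/-- The mild solution `v(t, v₀, ξ) = G(t) v₀ + ∫₀ᵗ G(t - s) B ξ(s) ds`. -/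
def mildSolution (G : C0Semigroup H) (B : Ξ →L[ℂ] H) (v₀ : H) (ξ : ℝ → Ξ) (t : ℝ) : H :=
  G.toFun t v₀ + ∫ s in (0 : ℝ)..t, G.toFun (t - s) (B (ξ s))

/-- `L₂(0, +∞; E)`. -/
abbrev L2Half (E : Type*) [NormedAddCommGroup E] : Type _ :=
  Lp E 2 (volume.restrict (Ioi (0 : ℝ)))

/-- `L₂(0, +∞; Hα) × L₂(0, +∞; Ξ)` with its Hilbert space structure. -/
abbrev ProcessSpace (Hα Ξ : Type*) [NormedAddCommGroup Hα] [NormedAddCommGroup Ξ] : Type _ :=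
  WithLp 2 (L2Half Hα × L2Half Ξ)

/-- The processes through `v₀`: the pairs `(v, ξ)` such that `v` is (a.e.) the mild solution with
control `ξ` and `v(0) = v₀`. Here `ι` is the embedding of `Hα` into `H`. -/
def processes (G : C0Semigroup H) (B : Ξ →L[ℂ] H) (ι : Hα →L[ℂ] H) (v₀ : Hα) :
    Set (ProcessSpace Hα Ξ) :=
  {z | ∀ᵐ t ∂(volume.restrict (Ioi (0 : ℝ))),
    ι (z.fst t) = mildSolution G B (ι v₀) (z.snd : ℝ → Ξ) t}

/-- `L₂`-controllability with respect to initial data in `Hα`. -/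
def L2Controllable (G : C0Semigroup H) (B : Ξ →L[ℂ] H) (ι : Hα →L[ℂ] H) : Prop :=
  ∀ v₀ : Hα, ∃ ξ : L2Half Ξ, ∃ v : L2Half Hα, ∀ᵐ t ∂(volume.restrict (Ioi (0 : ℝ))),
    ι (v t) = mildSolution G B (ι v₀) (ξ : ℝ → Ξ) t

/-- The coefficients of a form
`F(v, ξ) = (F₁ v, v)_α + 2 Re (F₂ v, ξ)_Ξ + (F₃ ξ, ξ)_Ξ`. -/
structure FormData (Hα Ξ : Type*) [NormedAddCommGroup Hα] [InnerProductSpace ℂ Hα]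
    [CompleteSpace Hα] [NormedAddCommGroup Ξ] [InnerProductSpace ℂ Ξ] [CompleteSpace Ξ] where
  F₁ : Hα →L[ℂ] Hα
  F₂ : Hα →L[ℂ] Ξ
  F₃ : Ξ →L[ℂ] Ξ
  selfAdjoint₁ : IsSelfAdjoint F₁
  selfAdjoint₃ : IsSelfAdjoint F₃

/-- The form `F(v, ξ)`. The first and the last term are real, by self-adjointness, so that taking
their real parts only makes the form real-valued. -/
def FormData.form (F : FormData Hα Ξ) (v : Hα) (ξ : Ξ) : ℝ :=
  (inner ℂ (F.F₁ v) v).re + 2 * (inner ℂ (F.F₂ v) ξ).re + (inner ℂ (F.F₃ ξ) ξ).re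

/-- The functional `J(v, ξ) = ∫₀^∞ F(v(t), ξ(t)) dt`. -/
def FormData.cost (F : FormData Hα Ξ) (z : ProcessSpace Hα Ξ) : ℝ :=
  ∫ t in Ioi (0 : ℝ), F.form (z.fst t) (z.snd t)

/-- `z` is a minimum point of the functional `J` on the set of processes through `v₀`. -/
def IsOptimalProcess (G : C0Semigroup H) (B : Ξ →L[ℂ] H) (ι : Hα →L[ℂ] H) (F : FormData Hα Ξ)
    (v₀ : Hα) (z : ProcessSpace Hα Ξ) : Prop :=
  z ∈ processes G B ι v₀ ∧ IsMinOn F.cost (processes G B ι v₀) z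

/-- `α₁`, an infimum in the extended reals (so `+∞` if the zero process is the only one). -/
def alpha₁ (G : C0Semigroup H) (B : Ξ →L[ℂ] H) (ι : Hα →L[ℂ] H) (F : FormData Hα Ξ) : EReal :=
  ⨅ (z : ProcessSpace Hα Ξ) (_ : z ∈ processes G B ι 0) (_ : z ≠ 0),
    ((F.cost z / (‖z.fst‖ ^ 2 + ‖z.snd‖ ^ 2) : ℝ) : EReal)

/-- `α₂`: the infimum over all `ω`, `v ∈ D(A)` and `ξ`, not both zero, with
`i ω v = A v + B ξ`. -/
def alpha₂ (A : H →ₗ.[ℂ] H) (B : Ξ →L[ℂ] H) (ι : Hα →L[ℂ] H) (F : FormData Hα Ξ) : EReal :=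
  ⨅ (ω : ℝ) (v : Hα) (ξ : Ξ)
    (_ : ∃ h : ι v ∈ A.domain, (Complex.I * ω) • ι v = A ⟨ι v, h⟩ + B ξ) (_ : (v, ξ) ≠ 0),
    ((F.form v ξ / (‖v‖ ^ 2 + ‖ξ‖ ^ 2) : ℝ) : EReal)

/-- `(A - z I)⁻¹ y` as an element of `Hα`: the preimage of the resolvent under the embedding `ι`
(which is injective, with a range that contains `D(A)`, wherever this is used). -/
def resolventIn (A : H →ₗ.[ℂ] H) (ι : Hα →L[ℂ] H) (z : ℂ) (y : H) : Hα :=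
  Function.invFun ι (opResolvent A z y)

/-- `α₃`. -/
def alpha₃ (A : H →ₗ.[ℂ] H) (B : Ξ →L[ℂ] H) (ι : Hα →L[ℂ] H) (F : FormData Hα Ξ) : EReal :=
  ⨅ (ω : ℝ) (ξ : Ξ) (_ : ξ ≠ 0),
    ((F.form (-resolventIn A ι (Complex.I * ω) (B ξ)) ξ / ‖ξ‖ ^ 2 : ℝ) : EReal)

/-- `α₃` is well-defined: `A` has no spectrum on the imaginary axis and the operators
`(A - i ω I)⁻¹ B : Ξ → Hα` are bounded uniformly in `ω`. -/
def Alpha₃WellDefined (A : H →ₗ.[ℂ] H) (B : Ξ →L[ℂ] H) (ι : Hα →L[ℂ] H) : Prop :=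
  (∀ ω : ℝ, Complex.I * ω ∉ opSpectrum A) ∧
    ∃ C : ℝ, ∀ (ω : ℝ) (ξ : Ξ), ‖resolventIn A ι (Complex.I * ω) (B ξ)‖ ≤ C * ‖ξ‖

end FreqThm

end

/-!
The first part rests on a linear picture of the processes: the pairs `(v₀, z)` of an initial
state and a process `z` through it form a closed linear relation (`isClosed_processRelation`), and
the cost is the quadratic form of a bounded self-adjoint operator on the space of processes
(`FormData.cost_eq`).

If `α₁ > 0`, that form is coercive on the processes through `0`, so on each fibre of the relation it
has exactly one minimizer, singled out by an orthogonality condition. Those conditions are linear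
and closed in `(v₀, z)`, so the closed graph theorem makes the minimizer a bounded linear function
`S v₀` (`exists_clm_minimizer`), and `P` is the compression of the cost operator by `S`. The
dissipation inequality is dynamic programming: a continuous trajectory on `[0, T]` followed by the
optimal process through its end point competes with the optimal process through `v₀`
(`exists_concat_process`).

`α₁ > 0` implies `α₂ > 0`: the dissipation inequality holds for the form decreased by a small
multiple of `|v|² + |ξ|²`. A solution of `i ω v = A v + B ξ` yields the trajectory `e^{i ω t} v`,
along which the optimal cost is constant, so the decreased form is nonnegative at `(v, ξ)`.

`α₂ > 0` implies `α₁ > 0` by Plancherel's theorem, once the Fourier transform of a process through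
`0` is known to satisfy `i ω v = A v + B ξ` at almost every frequency
(`exists_frequency_representation`). Since the semigroup may grow, no resolvent is available for
this. Instead, the Laplace transforms `V(p)`, `X(p)` of state and control are shown to satisfy
`e^{p h} V = G(h) V + ∫₀ʰ e^{p (h - r)} G(r) B X dr` for all `h ≥ 0` and `Re p > 0`
(`laplace_pastConvolution`). In this form the equation contains only bounded operators, so it passes
to the imaginary axis, where the Laplace transforms converge almost everywhere along a subsequence;
differentiation at `h = 0` then gives the equation with `A`, directly from the definition of the
generator (`exists_mem_domain_of_integral_eq`).

The equivalence of `α₂ > 0` and `α₃ > 0` is the substitution `v = -(A - i ω)⁻¹ B ξ`.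
-/

open MeasureTheory Set Filter Topology

noncomputable section

namespace FreqThm

/-! ### The Fourier transform of Hilbert space valued functions -/

section Fourier

open FourierTransform SchwartzMap

variable {E E' : Type*} [NormedAddCommGroup E] [InnerProductSpace ℂ E] [CompleteSpace E]
  [NormedAddCommGroup E'] [InnerProductSpace ℂ E'] [CompleteSpace E']

/-- On `L¹ ∩ L²` the `L²` Fourier transform is given by the Fourier integral. -/
theorem fourier_toLp_ae_eq {f : ℝ → E} (h1 : Integrable f) (h2 : MemLp f 2) :
    (𝓕 (h2.toLp f) : Lp (α := ℝ) E 2) =ᵐ[volume] 𝓕 f := by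
  -- The two functions define the same tempered distribution; it suffices to test them against
  -- real test functions `g`.
  have hcont : Continuous (𝓕 f) :=
    VectorFourier.fourierIntegral_continuous Real.continuous_fourierChar
      (by exact continuous_inner) h1
  refine ae_eq_of_integral_contDiff_smul_eq
    ((Lp.memLp _).locallyIntegrable (by norm_num)) hcont.locallyIntegrable ?_
  intro g hg hgc
  have hgc' : HasCompactSupport (fun x => (g x : ℂ)) :=
    hgc.comp_left (g := fun x : ℝ => (x : ℂ)) rfl
  let φ : 𝓢(ℝ, ℂ) := hgc'.toSchwartzMap (Complex.ofRealCLM.contDiff.comp hg)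
  have hφ : ∀ x, φ x = (g x : ℂ) := fun x => rfl
  have key := congrArg (fun T => T φ) (Lp.fourier_toTemperedDistribution_eq (h2.toLp f))
  simp only [TemperedDistribution.fourier_apply, Lp.toTemperedDistribution_apply] at key
  have e1 : ∫ x, g x • (𝓕 (h2.toLp f) : Lp E 2 (volume : Measure ℝ)) x
      = ∫ x, φ x • (𝓕 (h2.toLp f) : Lp E 2 (volume : Measure ℝ)) x := by
    refine integral_congr_ae (Eventually.of_forall fun x => ?_)
    simp [hφ]
  have e2 : ∫ x, g x • 𝓕 f x = ∫ x, φ x • 𝓕 f x := by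
    refine integral_congr_ae (Eventually.of_forall fun x => ?_)
    simp [hφ]
  rw [e1, e2, ← key]
  have e3 : ∫ x, (𝓕 φ) x • (h2.toLp f) x = ∫ x, (𝓕 φ) x • f x := by
    refine integral_congr_ae ?_
    filter_upwards [h2.coeFn_toLp] with x hx
    rw [hx]
  rw [e3, SchwartzMap.fourier_coe]
  have h := VectorFourier.integral_fourierIntegral_smul_eq_flip (L := innerₗ ℝ)
    Real.continuous_fourierChar continuous_inner (φ.integrable (μ := volume)) h1
  rw [flip_innerₗ] at h
  exact h

/-- The `L²` Fourier transform commutes with bounded operators on the target space. -/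
theorem fourier_compLp (Q : E →L[ℂ] E') (f : Lp (α := ℝ) E 2) :
    𝓕 (Q.compLp f) = Q.compLp (𝓕 f) := by
  refine DenseRange.induction_on
    (p := fun f : Lp (α := ℝ) E 2 => 𝓕 (Q.compLp f) = Q.compLp (𝓕 f))
    (SchwartzMap.denseRange_toLpCLM (p := 2) ENNReal.ofNat_ne_top) f ?_ ?_
  · refine isClosed_eq ?_ ?_
    · exact (Lp.fourierTransformₗᵢ ℝ E').continuous.comp
        (Q.compLpL 2 (volume : Measure ℝ)).continuous
    · exact (Q.compLpL 2 (volume : Measure ℝ)).continuous.comp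
        (Lp.fourierTransformₗᵢ ℝ E).continuous
  intro φ
  have hQ1 : Integrable (fun x => Q (φ x)) := Q.integrable_comp φ.integrable
  have hQ2 : MemLp (fun x => Q (φ x)) 2 (volume : Measure ℝ) := Q.comp_memLp' (φ.memLp 2)
  have e1 : Q.compLp (φ.toLp 2) = hQ2.toLp (fun x => Q (φ x)) := by
    refine Lp.ext ?_
    filter_upwards [Q.coeFn_compLp (φ.toLp 2), hQ2.coeFn_toLp, φ.coeFn_toLp 2] with x h1 h2 h3
    rw [h1, h2, h3]
  simp only [SchwartzMap.toLpCLM_apply]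
  rw [e1, SchwartzMap.toLp_fourier_eq]
  refine Lp.ext ?_
  filter_upwards [fourier_toLp_ae_eq hQ1 hQ2, Q.coeFn_compLp ((𝓕 φ).toLp 2),
    (𝓕 φ).coeFn_toLp 2] with x h1 h2 h3
  rw [h1, h2, h3, SchwartzMap.fourier_coe, Real.fourier_eq, Real.fourier_eq,
    ← Q.integral_comp_comm]
  · refine integral_congr_ae (Eventually.of_forall fun t => ?_)
    simp [Circle.smul_def]
  · exact (Real.fourierIntegral_convergent_iff x).2 φ.integrable

end Fourier

/-! ### Semigroups and mild solutions -/

section Semigroup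

variable {H Ξ : Type*}
  [NormedAddCommGroup H] [InnerProductSpace ℂ H]
  [NormedAddCommGroup Ξ] [InnerProductSpace ℂ Ξ]

theorem mildSolution_congr (G : C0Semigroup H) (B : Ξ →L[ℂ] H) {v₀ : H} {ξ η : ℝ → Ξ}
    {t : ℝ} (ht : 0 ≤ t)
    (h : ξ =ᵐ[volume.restrict (Ioc 0 t)] η) :
    mildSolution G B v₀ ξ t = mildSolution G B v₀ η t := by
  unfold mildSolution
  rw [intervalIntegral.integral_of_le ht, intervalIntegral.integral_of_le ht]
  congr 1
  refine integral_congr_ae ?_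
  filter_upwards [h] with s hs
  rw [hs]

theorem hasDerivWithinAt_semigroup {G : C0Semigroup H} {A : H →ₗ.[ℂ] H} (hA : IsGenerator A G)
    (x : A.domain) {t : ℝ} (ht : 0 ≤ t) :
    HasDerivWithinAt (fun s => G.toFun s x) (G.toFun t (A x)) (Ioi t) t := by
  have h := (hA x (A x)).1 ⟨x.2, rfl⟩
  have h2 := ((G.toFun t).continuous.tendsto _).comp h
  refine (hasDerivWithinAt_iff_tendsto_slope' (lt_irrefl t)).2 ?_
  have h3 : Tendsto (fun s : ℝ => s - t) (𝓝[>] t) (𝓝[>] 0) := by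
    refine tendsto_nhdsWithin_iff.2 ⟨?_, ?_⟩
    · have : Tendsto (fun s : ℝ => s - t) (𝓝 t) (𝓝 (t - t)) :=
        (continuous_id.sub continuous_const).tendsto t
      rw [sub_self] at this
      exact this.mono_left nhdsWithin_le_nhds
    · filter_upwards [self_mem_nhdsWithin] with s hs
      exact sub_pos.2 (mem_Ioi.1 hs)
  refine (h2.comp h3).congr' ?_
  filter_upwards [self_mem_nhdsWithin] with s hs
  have hst : 0 ≤ s - t := (sub_pos.2 (mem_Ioi.1 hs)).le
  have : G.toFun s = (G.toFun t).comp (G.toFun (s - t)) := by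
    rw [← G.map_add t (s - t) ht hst]; congr 1; ring
  simp only [Function.comp, slope_def_module, this, ContinuousLinearMap.comp_apply,
    Complex.coe_smul, ContinuousLinearMap.map_smul_of_tower, map_sub]

/-- Uniform boundedness: a strongly continuous semigroup is bounded on bounded time intervals. -/
theorem C0Semigroup.exists_norm_le [CompleteSpace H] (G : C0Semigroup H) (T : ℝ) :
    ∃ M, 0 ≤ M ∧ ∀ t ∈ Icc 0 T, ‖G.toFun t‖ ≤ M := by
  obtain ⟨C, hC⟩ := banach_steinhaus (g := fun t : Icc (0 : ℝ) T => G.toFun t) (by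
    intro x
    obtain ⟨C, hC⟩ := isCompact_Icc.exists_bound_of_continuousOn
      ((G.continuousOn x).mono (Icc_subset_Ici_self : Icc 0 T ⊆ Ici 0))
    exact ⟨C, fun t => hC t t.2⟩)
  exact ⟨max C 0, le_max_right _ _, fun t ht => (hC ⟨t, ht⟩).trans (le_max_left _ _)⟩

/-- Joint continuity of `(t, x) ↦ G(t) x`, the semigroup being frozen at negative times. -/
theorem C0Semigroup.continuous_uncurry [CompleteSpace H] (G : C0Semigroup H) :
    Continuous fun p : ℝ × H => G.toFun (max p.1 0) p.2 := by
  rw [continuous_iff_continuousAt]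
  rintro ⟨t₀, x₀⟩
  obtain ⟨M, hM0, hM⟩ := G.exists_norm_le (|t₀| + 1)
  have h1 : Tendsto (fun p : ℝ × H => G.toFun (max p.1 0) x₀) (𝓝 (t₀, x₀))
      (𝓝 (G.toFun (max t₀ 0) x₀)) := by
    have hc : Continuous fun t : ℝ => G.toFun (max t 0) x₀ :=
      (G.continuousOn x₀).comp_continuous (by fun_prop) (fun t => mem_Ici.2 (le_max_right _ _))
    exact (hc.comp continuous_fst).tendsto (t₀, x₀)
  -- Locally uniform boundedness of `‖G(t)‖` handles the change of the vector.
  have h2 : Tendsto (fun p : ℝ × H => G.toFun (max p.1 0) (p.2 - x₀)) (𝓝 (t₀, x₀)) (𝓝 0) := by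
    have hb : ∀ᶠ p : ℝ × H in 𝓝 (t₀, x₀),
        ‖G.toFun (max p.1 0) (p.2 - x₀)‖ ≤ M * ‖p.2 - x₀‖ := by
      have : ∀ᶠ p : ℝ × H in 𝓝 (t₀, x₀), p.1 < |t₀| + 1 :=
        continuous_fst.continuousAt.eventually_lt continuousAt_const
          (by have := le_abs_self t₀; simp only; linarith)
      filter_upwards [this] with p hp
      refine ((G.toFun _).le_opNorm _).trans ?_
      gcongr
      exact hM _ ⟨le_max_right _ _, max_le hp.le (by positivity)⟩
    refine squeeze_zero_norm' hb ?_
    have : Continuous fun p : ℝ × H => M * ‖p.2 - x₀‖ := by fun_prop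
    simpa using this.tendsto (t₀, x₀)
  have h3 := h2.add h1
  rw [zero_add] at h3
  refine h3.congr fun p => ?_
  rw [← _root_.map_add, sub_add_cancel]

variable [CompleteSpace H] (G : C0Semigroup H) (B : Ξ →L[ℂ] H)

theorem integrableOn_convolution {ξ : ℝ → Ξ} {t : ℝ} (hξ : IntegrableOn ξ (Ioc 0 t)) :
    IntegrableOn (fun s => G.toFun (t - s) (B (ξ s))) (Ioc 0 t) := by
  obtain ⟨M, hM0, hM⟩ := G.exists_norm_le t
  have hm : AEStronglyMeasurable (fun s => G.toFun (max (t - s) 0) (B (ξ s)))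
      (volume.restrict (Ioc 0 t)) :=
    G.continuous_uncurry.comp_aestronglyMeasurable
      ((by fun_prop : Continuous fun s : ℝ => t - s).aestronglyMeasurable.prodMk
        (B.continuous.comp_aestronglyMeasurable hξ.aestronglyMeasurable))
  have hm' : AEStronglyMeasurable (fun s => G.toFun (t - s) (B (ξ s)))
      (volume.restrict (Ioc 0 t)) := by
    refine hm.congr ?_
    filter_upwards [ae_restrict_mem measurableSet_Ioc] with s hs
    rw [max_eq_left (by linarith [hs.2])]
  refine Integrable.mono' (hξ.norm.const_mul (M * ‖B‖)) hm' ?_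
  filter_upwards [ae_restrict_mem measurableSet_Ioc] with s hs
  calc ‖G.toFun (t - s) (B (ξ s))‖ ≤ ‖G.toFun (t - s)‖ * ‖B (ξ s)‖ := (G.toFun _).le_opNorm _
    _ ≤ M * (‖B‖ * ‖ξ s‖) := by
        gcongr
        · exact hM _ ⟨by linarith [hs.2], by linarith [hs.1]⟩
        · exact B.le_opNorm _
    _ = M * ‖B‖ * ‖ξ s‖ := by ring

/-- The cocycle property: a mild solution restarted at time `T` is a mild solution. -/
theorem mildSolution_add_time {v₀ : H} {ξ : ℝ → Ξ} {T s : ℝ} (hT : 0 ≤ T) (hs : 0 ≤ s)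
    (hξ : IntegrableOn ξ (Ioc 0 (T + s))) :
    mildSolution G B v₀ ξ (T + s) =
      mildSolution G B (mildSolution G B v₀ ξ T) (fun r => ξ (T + r)) s := by
  have hi := integrableOn_convolution G B hξ
  have hi1 : IntervalIntegrable (fun r => G.toFun (T + s - r) (B (ξ r))) volume 0 T :=
    (intervalIntegrable_iff_integrableOn_Ioc_of_le hT).2
      (hi.mono_set (Ioc_subset_Ioc_right (by linarith)))
  have hi2 : IntervalIntegrable (fun r => G.toFun (T + s - r) (B (ξ r))) volume T (T + s) :=
    (intervalIntegrable_iff_integrableOn_Ioc_of_le (by linarith)).2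
      (hi.mono_set (Ioc_subset_Ioc_left hT))
  have hi3 : IntervalIntegrable (fun r => G.toFun (T - r) (B (ξ r))) volume 0 T :=
    (intervalIntegrable_iff_integrableOn_Ioc_of_le hT).2
      (integrableOn_convolution G B (hξ.mono_set (Ioc_subset_Ioc_right (by linarith))))
  unfold mildSolution
  rw [← intervalIntegral.integral_add_adjacent_intervals hi1 hi2, map_add, ← add_assoc]
  congr 1
  · congr 1
    · rw [add_comm T s, G.map_add s T hs hT]; rfl
    · rw [← (G.toFun s).intervalIntegral_comp_comm hi3]
      refine intervalIntegral.integral_congr fun r hr => ?_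
      rw [uIcc_of_le hT] at hr
      rw [show T + s - r = s + (T - r) by ring, G.map_add s (T - r) hs (by linarith [hr.2])]
      rfl
  · have := intervalIntegral.integral_comp_add_left (a := 0) (b := s)
      (fun r => G.toFun (T + s - r) (B (ξ r))) T
    rw [add_zero] at this
    rw [← this]
    refine intervalIntegral.integral_congr fun r _ => ?_
    simp only [show T + s - (T + r) = s - r by ring]

theorem integrableOn_Ioc_of_memLp {E : Type*} [NormedAddCommGroup E] {f : ℝ → E} {t : ℝ}
    (hf : MemLp f 2 (volume.restrict (Ioi (0 : ℝ)))) : IntegrableOn f (Ioc 0 t) :=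
  (hf.mono_measure (Measure.restrict_mono_set _ Ioc_subset_Ioi_self)).integrable (by norm_num)

/-- At each fixed time the mild solution is a bounded linear function of initial state and
control. -/
theorem exists_mildSolution_clm {t : ℝ} (ht : 0 ≤ t) :
    ∃ Φ : (H × L2Half Ξ) →L[ℂ] H, ∀ v₀ (ξ : L2Half Ξ), Φ (v₀, ξ) = mildSolution G B v₀ ξ t := by
  obtain ⟨M, hM0, hM⟩ := G.exists_norm_le t
  have hint : ∀ ξ : L2Half Ξ, IntervalIntegrable (fun s => G.toFun (t - s) (B (ξ s))) volume 0 t :=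
    fun ξ => (intervalIntegrable_iff_integrableOn_Ioc_of_le ht).2
      (integrableOn_convolution G B (integrableOn_Ioc_of_memLp (Lp.memLp ξ)))
  let Φ : (H × L2Half Ξ) →ₗ[ℂ] H :=
    { toFun := fun p => mildSolution G B p.1 p.2 t
      map_add' := by
        rintro ⟨x, ξ⟩ ⟨y, η⟩
        have h1 : mildSolution G B (x + y) (ξ + η : L2Half Ξ) t
            = mildSolution G B (x + y) (fun s => ξ s + η s) t :=
          mildSolution_congr G B ht (ae_restrict_of_ae_restrict_of_subset Ioc_subset_Ioi_self
            (Lp.coeFn_add ξ η))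
        simp only [Prod.mk_add_mk]
        rw [h1]
        unfold mildSolution
        simp only [map_add]
        rw [intervalIntegral.integral_add (hint ξ) (hint η)]
        abel
      map_smul' := by
        rintro c ⟨x, ξ⟩
        have h1 : mildSolution G B (c • x) (c • ξ : L2Half Ξ) t
            = mildSolution G B (c • x) (fun s => c • ξ s) t :=
          mildSolution_congr G B ht (ae_restrict_of_ae_restrict_of_subset Ioc_subset_Ioi_self
            (Lp.coeFn_smul c ξ))
        simp only [Prod.smul_mk]
        rw [h1]
        unfold mildSolution
        simp only [map_smul, RingHom.id_apply, smul_add]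
        rw [intervalIntegral.integral_smul] }
  refine ⟨Φ.mkContinuous (M + M * ‖B‖ * √t) ?_, fun _ _ => rfl⟩
  rintro ⟨x, ξ⟩
  -- On a bounded interval the `L²` norm controls the `L¹` norm.
  have hL1 : ∫ s in Ioc 0 t, ‖ξ s‖ ≤ √t * ‖ξ‖ := by
    have hm : MemLp ξ 2 (volume.restrict (Ioc 0 t)) :=
      (Lp.memLp ξ).mono_measure (Measure.restrict_mono_set _ Ioc_subset_Ioi_self)
    have h1 := eLpNorm_le_eLpNorm_mul_rpow_measure_univ (p := 1) (q := 2) (by norm_num)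
      hm.aestronglyMeasurable
    have h2 : eLpNorm ξ 2 (volume.restrict (Ioc 0 t)) ≤ eLpNorm ξ 2 (volume.restrict (Ioi 0)) :=
      eLpNorm_mono_measure _ (Measure.restrict_mono_set _ Ioc_subset_Ioi_self)
    have h3 : eLpNorm ξ 1 (volume.restrict (Ioc 0 t))
        ≤ eLpNorm ξ 2 (volume.restrict (Ioi 0)) * ENNReal.ofReal (√t) := by
      refine h1.trans (mul_le_mul' h2 ?_)
      rw [Measure.restrict_apply_univ, Real.volume_Ioc, sub_zero, Real.sqrt_eq_rpow,
        ENNReal.ofReal_rpow_of_nonneg ht (by norm_num)]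
      norm_num
    rw [integral_norm_eq_lintegral_enorm hm.aestronglyMeasurable, ← eLpNorm_one_eq_lintegral_enorm]
    refine (ENNReal.toReal_mono (ENNReal.mul_ne_top (Lp.eLpNorm_ne_top ξ) ENNReal.ofReal_ne_top)
      h3).trans ?_
    rw [ENNReal.toReal_mul, ENNReal.toReal_ofReal (Real.sqrt_nonneg t), mul_comm, Lp.norm_def]
  have hint' : ‖∫ s in (0 : ℝ)..t, G.toFun (t - s) (B (ξ s))‖ ≤ M * ‖B‖ * (√t * ‖ξ‖) := by
    rw [intervalIntegral.integral_of_le ht]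
    refine (norm_integral_le_of_norm_le (g := fun s => M * ‖B‖ * ‖ξ s‖)
      ((integrableOn_Ioc_of_memLp (Lp.memLp ξ)).norm.const_mul _) ?_).trans ?_
    · filter_upwards [ae_restrict_mem measurableSet_Ioc] with s hs
      calc ‖G.toFun (t - s) (B (ξ s))‖ ≤ ‖G.toFun (t - s)‖ * ‖B (ξ s)‖ := (G.toFun _).le_opNorm _
        _ ≤ M * (‖B‖ * ‖ξ s‖) := by
            gcongr
            · exact hM _ ⟨by linarith [hs.2], by linarith [hs.1]⟩
            · exact B.le_opNorm _
        _ = M * ‖B‖ * ‖ξ s‖ := by ring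
    · rw [integral_const_mul]
      gcongr
  change ‖G.toFun t x + ∫ s in (0 : ℝ)..t, G.toFun (t - s) (B (ξ s))‖ ≤ _
  calc _ ≤ ‖G.toFun t x‖ + ‖∫ s in (0 : ℝ)..t, G.toFun (t - s) (B (ξ s))‖ := norm_add_le _ _
    _ ≤ M * ‖x‖ + M * ‖B‖ * (√t * ‖ξ‖) :=
        add_le_add (((G.toFun t).le_opNorm x).trans (by gcongr; exact hM t ⟨ht, le_rfl⟩)) hint'
    _ ≤ M * ‖(x, ξ)‖ + M * ‖B‖ * (√t * ‖(x, ξ)‖) := by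
        gcongr
        · exact norm_fst_le (x, ξ)
        · exact norm_snd_le (x, ξ)
    _ = _ := by ring

variable {G B}

/-- A solution of `i ω v = A v + B ξ` gives the periodic process `e^{i ω t} (v, ξ)`. -/
theorem mildSolution_periodic {A : H →ₗ.[ℂ] H} (hA : IsGenerator A G) {ω : ℝ} (x : A.domain)
    {ξ : Ξ} (h : (Complex.I * ω) • (x : H) = A x + B ξ) {t : ℝ} (ht : 0 ≤ t) :
    mildSolution G B x (fun s => Complex.exp (Complex.I * ω * s) • ξ) t
      = Complex.exp (Complex.I * ω * t) • (x : H) := by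
  have hBξ : B ξ = (Complex.I * ω) • (x : H) - A x := by rw [h]; abel
  have hexp : ∀ r : ℝ, HasDerivAt (fun r : ℝ => Complex.exp (-(Complex.I * ω) * r))
      (Complex.exp (-(Complex.I * ω) * r) * (-(Complex.I * ω))) r := by
    intro r
    have h1 : HasDerivAt (fun r : ℝ => -(Complex.I * ω) * (r : ℂ)) (-(Complex.I * ω) * 1) r :=
      (Complex.ofRealCLM.hasDerivAt (x := r)).const_mul _
    rw [mul_one] at h1
    exact h1.cexp
  have hcexp : Continuous fun r : ℝ => Complex.exp (-(Complex.I * ω) * r) := by fun_prop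
  have hcont : ∀ y : H, ContinuousOn
      (fun r : ℝ => Complex.exp (-(Complex.I * ω) * r) • G.toFun r y) (Icc 0 t) := fun y =>
    hcexp.continuousOn.smul ((G.continuousOn y).mono Icc_subset_Ici_self)
  -- The function `r ↦ e^{-i ω r} G(r) x` has right derivative `-e^{-i ω r} G(r) B ξ`.
  have hftc : ∫ r in (0 : ℝ)..t, -(Complex.exp (-(Complex.I * ω) * r) • G.toFun r (B ξ))
      = Complex.exp (-(Complex.I * ω) * t) • G.toFun t x - (x : H) := by
    rw [intervalIntegral.integral_eq_sub_of_hasDeriv_right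
      (f := fun r : ℝ => Complex.exp (-(Complex.I * ω) * r) • G.toFun r x)]
    · simp [G.map_zero]
    · rw [uIcc_of_le ht]; exact hcont x
    · intro r hr
      rw [min_eq_left ht] at hr
      have := (hexp r).hasDerivWithinAt.smul (hasDerivWithinAt_semigroup hA x hr.1.le)
      refine this.congr_deriv ?_
      rw [hBξ, map_sub, map_smul, smul_sub, smul_smul, mul_neg, neg_smul, neg_sub, sub_eq_add_neg]
    · refine ContinuousOn.intervalIntegrable ?_
      rw [uIcc_of_le ht]; exact (hcont _).neg
  have hsub : ∫ s in (0 : ℝ)..t, G.toFun (t - s) (B (Complex.exp (Complex.I * ω * s) • ξ))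
      = Complex.exp (Complex.I * ω * t) •
        ∫ r in (0 : ℝ)..t, Complex.exp (-(Complex.I * ω) * r) • G.toFun r (B ξ) := by
    rw [← intervalIntegral.integral_smul]
    have := intervalIntegral.integral_comp_sub_left (a := 0) (b := t)
      (fun r : ℝ => Complex.exp (Complex.I * ω * t) •
        Complex.exp (-(Complex.I * ω) * r) • G.toFun r (B ξ)) t
    rw [sub_self, sub_zero] at this
    rw [← this]
    refine intervalIntegral.integral_congr fun s _ => ?_
    simp only [map_smul, smul_smul, ← Complex.exp_add]
    congr 2
    push_cast
    ring
  unfold mildSolution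
  rw [intervalIntegral.integral_neg, neg_eq_iff_eq_neg] at hftc
  rw [hsub, hftc, neg_sub, smul_sub, smul_smul, ← Complex.exp_add]
  simp

end Semigroup

/-! ### Minimization of a quadratic functional on a linear family of affine subspaces -/

section Quadratic

variable {X Z : Type*} [NormedAddCommGroup X] [NormedSpace ℂ X] [CompleteSpace X]
  [NormedAddCommGroup Z] [InnerProductSpace ℂ Z] [CompleteSpace Z]

/-- Lax-Milgram on a closed subspace. -/
theorem exists_mem_inner_eq_of_coercive {Q : Z →L[ℂ] Z} {M : Submodule ℂ Z}
    (hM : IsClosed (M : Set Z)) {c : ℝ} (hc : 0 < c)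
    (hQ : ∀ m ∈ M, c * ‖m‖ ^ 2 ≤ (inner ℂ (Q m) m).re) (y : Z) :
    ∃ m ∈ M, ∀ w ∈ M, inner ℂ (Q m) w = inner ℂ y w := by
  have : CompleteSpace M := hM.completeSpace_coe
  let L : M →L[ℂ] M := (ContinuousLinearMap.adjoint M.subtypeL) ∘L Q ∘L M.subtypeL
  have hL : ∀ m w : M, inner ℂ (L m) w = inner ℂ (Q m) (w : Z) := fun m w => by
    simp only [L, ContinuousLinearMap.comp_apply, ContinuousLinearMap.adjoint_inner_left]
    rfl
  have hu : IsUnit L := by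
    refine L.isUnit_of_forall_le_norm_inner_map (c := ⟨c, hc.le⟩) hc fun m => ?_
    rw [hL]
    calc ‖m‖ ^ 2 * c = c * ‖(m : Z)‖ ^ 2 := by rw [mul_comm]; rfl
      _ ≤ _ := hQ m m.2
      _ ≤ _ := (le_abs_self _).trans (Complex.abs_re_le_norm _)
  obtain ⟨m, hm⟩ := (ContinuousLinearMap.isUnit_iff_bijective.1 hu).2
    (ContinuousLinearMap.adjoint M.subtypeL y)
  refine ⟨m, m.2, fun w hw => ?_⟩
  have := hL m ⟨w, hw⟩
  rw [hm, ContinuousLinearMap.adjoint_inner_left] at this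
  exact this.symm

/-- Let `N` be a closed linear relation whose fibre over every `x` is a nonempty affine subspace,
and let the quadratic form of `Q` be coercive on the fibre over `0`. The minimizer of the form on
the fibre over `x` is the only point `z` of that fibre for which `Q z` is orthogonal to the fibre over
`0`. These conditions define a closed linear relation, hence by the closed graph theorem a bounded
linear operator `x ↦ z`. -/
theorem exists_clm_minimizer {Q : Z →L[ℂ] Z} (hQs : IsSelfAdjoint Q) {N : Submodule ℂ (X × Z)}
    (hN : IsClosed (N : Set (X × Z))) (hne : ∀ x, ∃ z, (x, z) ∈ N) {c : ℝ} (hc : 0 < c)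
    (hQ : ∀ m, ((0 : X), m) ∈ N → c * ‖m‖ ^ 2 ≤ (inner ℂ (Q m) m).re) :
    ∃ S : X →L[ℂ] Z, ∀ x, (x, S x) ∈ N ∧ ∀ z, (x, z) ∈ N →
      (inner ℂ (Q (S x)) (S x)).re + c * ‖z - S x‖ ^ 2 ≤ (inner ℂ (Q z) z).re := by
  let M : Submodule ℂ Z := N.comap (LinearMap.inr ℂ X Z)
  have hM : ∀ m, m ∈ M ↔ ((0 : X), m) ∈ N := fun m => Iff.rfl
  have hMc : IsClosed (M : Set Z) :=
    hN.preimage (by fun_prop : Continuous fun z : Z => ((0 : X), z))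
  let K : Submodule ℂ (X × Z) :=
    { carrier := {p | p ∈ N ∧ ∀ w ∈ M, inner ℂ (Q p.2) w = 0}
      add_mem' := by
        rintro a b ⟨ha, ha'⟩ ⟨hb, hb'⟩
        refine ⟨N.add_mem ha hb, fun w hw => ?_⟩
        simp [ha' w hw, hb' w hw]
      zero_mem' := ⟨N.zero_mem, by simp⟩
      smul_mem' := by
        rintro r a ⟨ha, ha'⟩
        refine ⟨N.smul_mem r ha, fun w hw => ?_⟩
        simp [ha' w hw] }
  have hK : IsClosed (K : Set (X × Z)) := by
    have : (K : Set (X × Z)) =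
        (N : Set (X × Z)) ∩ ⋂ w ∈ M, {p : X × Z | inner ℂ (Q p.2) w = 0} := by
      ext p; simp [K]
    rw [this]
    refine hN.inter (isClosed_biInter fun w _ => isClosed_eq ?_ continuous_const)
    exact (Q.continuous.comp continuous_snd).inner continuous_const
  have hex : ∀ x, ∃! z, (x, z) ∈ K := by
    intro x
    obtain ⟨z₀, hz₀⟩ := hne x
    obtain ⟨m, hm, hm'⟩ := exists_mem_inner_eq_of_coercive hMc hc hQ (Q z₀)
    refine ⟨z₀ - m, ⟨?_, fun w hw => ?_⟩, ?_⟩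
    · have := N.sub_mem hz₀ ((hM m).1 hm)
      simpa using this
    · simp [hm' w hw]
    · rintro z ⟨hz, hz'⟩
      have hd : z - (z₀ - m) ∈ M := by
        have := N.add_mem (N.sub_mem hz hz₀) ((hM m).1 hm)
        rw [hM]
        convert this using 1
        ext <;> simp
        abel
      have h0 : inner ℂ (Q (z - (z₀ - m))) (z - (z₀ - m)) = 0 := by
        have h1 := hz' _ hd
        have h2 := hm' _ hd
        simp only at h1
        rw [map_sub, map_sub, inner_sub_left, inner_sub_left, h1, h2, sub_self, sub_zero]
      have h3 := hQ (z - (z₀ - m)) hd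
      rw [h0, Complex.zero_re] at h3
      have h4 : ‖z - (z₀ - m)‖ ^ 2 = 0 := by
        refine le_antisymm ?_ (sq_nonneg _)
        exact nonpos_of_mul_nonpos_right h3 hc
      exact sub_eq_zero.1 (norm_eq_zero.1 (pow_eq_zero_iff (two_ne_zero) |>.1 h4))
  choose S hS hSu using hex
  let S' : X →ₗ[ℂ] Z :=
    { toFun := S
      map_add' := fun x y => (hSu _ _ (K.add_mem (hS x) (hS y))).symm
      map_smul' := fun r x => (hSu _ _ (K.smul_mem r (hS x))).symm }
  have hgraph : (S'.graph : Set (X × Z)) = K := by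
    ext ⟨x, z⟩
    simp only [SetLike.mem_coe, LinearMap.mem_graph_iff]
    constructor
    · rintro rfl; exact hS x
    · intro h; exact hSu x z h
  refine ⟨⟨S', S'.continuous_of_isClosed_graph (by rw [hgraph]; exact hK)⟩, fun x =>
    ⟨(hS x).1, fun z hz => ?_⟩⟩
  change (inner ℂ (Q (S x)) (S x)).re + c * ‖z - S x‖ ^ 2 ≤ _
  have hd : z - S x ∈ M := by
    have := N.sub_mem hz (hS x).1
    rw [hM]
    convert this using 1
    ext <;> simp
  have h1 := hQ (z - S x) hd
  have h2 : inner ℂ (Q (S x)) (z - S x) = 0 := (hS x).2 _ hd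
  have h3 : inner ℂ (Q (z - S x)) (S x) = 0 := by
    rw [hQs.isSymmetric.apply_clm (z - S x) (S x), ← inner_conj_symm, h2, map_zero]
  have h4 : inner ℂ (Q z) z = inner ℂ (Q (S x)) (S x) + inner ℂ (Q (z - S x)) (z - S x) := by
    have : z = S x + (z - S x) := by abel
    conv_lhs => rw [this, map_add, inner_add_left, inner_add_right, inner_add_right, h2, h3]
    ring
  rw [h4, Complex.add_re]
  gcongr

end Quadratic

/-! ### Quadratic forms and the cost functional -/

section Forms

variable {Hα Ξ : Type*}
  [NormedAddCommGroup Hα] [InnerProductSpace ℂ Hα] [CompleteSpace Hα]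
  [NormedAddCommGroup Ξ] [InnerProductSpace ℂ Ξ] [CompleteSpace Ξ]

theorem integrable_re_inner_of_memLp {E : Type*} [NormedAddCommGroup E] [InnerProductSpace ℂ E]
    {α : Type*} [MeasurableSpace α] {μ : Measure α} {f g : α → E} (hf : MemLp f 2 μ)
    (hg : MemLp g 2 μ) : Integrable (fun t => (inner ℂ (f t) (g t)).re) μ := by
  have h := (L2.integrable_inner (𝕜 := ℂ) (hf.toLp f) (hg.toLp g)).re
  refine h.congr ?_
  filter_upwards [hf.coeFn_toLp, hg.coeFn_toLp] with t h1 h2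
  rw [h1, h2]
  rfl

theorem norm_sq_eq_integral {E : Type*} [NormedAddCommGroup E] [InnerProductSpace ℂ E]
    {α : Type*} [MeasurableSpace α] {μ : Measure α} (f : Lp E 2 μ) :
    ‖f‖ ^ 2 = ∫ t, (inner ℂ (f t) (f t)).re ∂μ := by
  rw [norm_sq_eq_re_inner (𝕜 := ℂ) f, L2.inner_def]
  exact (integral_re (L2.integrable_inner (𝕜 := ℂ) f f)).symm

variable (F : FormData Hα Ξ) {α : Type*} [MeasurableSpace α] {μ : Measure α}

theorem FormData.integrable_form {v : α → Hα} {ξ : α → Ξ} (hv : MemLp v 2 μ) (hξ : MemLp ξ 2 μ) :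
    Integrable (fun t => F.form (v t) (ξ t)) μ := by
  unfold FormData.form
  exact ((integrable_re_inner_of_memLp (F.F₁.comp_memLp' hv) hv).add
    ((integrable_re_inner_of_memLp (F.F₂.comp_memLp' hv) hξ).const_mul 2)).add
    (integrable_re_inner_of_memLp (F.F₃.comp_memLp' hξ) hξ)

theorem re_inner_compLp {E E' : Type*} [NormedAddCommGroup E] [InnerProductSpace ℂ E]
    [NormedAddCommGroup E'] [InnerProductSpace ℂ E'] (Q : E →L[ℂ] E') (f : Lp E 2 μ)
    (g : Lp E' 2 μ) :
    (inner ℂ (Q.compLp f) g).re = ∫ t, (inner ℂ (Q (f t)) (g t)).re ∂μ := by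
  rw [L2.inner_def]
  have h := integral_re (L2.integrable_inner (𝕜 := ℂ) (Q.compLp f) g)
  simp only [RCLike.re_to_complex] at h
  rw [← h]
  refine integral_congr_ae ?_
  filter_upwards [Q.coeFn_compLp f] with t ht
  rw [ht]

/-- The integral of the form in terms of inner products of `L²`. -/
theorem FormData.integral_form (v : Lp Hα 2 μ) (ξ : Lp Ξ 2 μ) :
    ∫ t, F.form (v t) (ξ t) ∂μ = (inner ℂ (F.F₁.compLp v) v).re
      + 2 * (inner ℂ (F.F₂.compLp v) ξ).re + (inner ℂ (F.F₃.compLp ξ) ξ).re := by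
  have h1 : Integrable (fun t => (inner ℂ (F.F₁ (v t)) (v t)).re) μ :=
    integrable_re_inner_of_memLp (F.F₁.comp_memLp' (Lp.memLp v)) (Lp.memLp v)
  have h2 : Integrable (fun t => (inner ℂ (F.F₂ (v t)) (ξ t)).re) μ :=
    integrable_re_inner_of_memLp (F.F₂.comp_memLp' (Lp.memLp v)) (Lp.memLp ξ)
  have h3 : Integrable (fun t => (inner ℂ (F.F₃ (ξ t)) (ξ t)).re) μ :=
    integrable_re_inner_of_memLp (F.F₃.comp_memLp' (Lp.memLp ξ)) (Lp.memLp ξ)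
  rw [re_inner_compLp, re_inner_compLp, re_inner_compLp, ← integral_const_mul,
    ← integral_add h1 (h2.const_mul 2), ← integral_add (by exact h1.add (h2.const_mul 2)) h3]
  rfl

theorem isSelfAdjoint_compLpL {E : Type*} [NormedAddCommGroup E] [InnerProductSpace ℂ E]
    [CompleteSpace E] {Q : E →L[ℂ] E} (hQ : IsSelfAdjoint Q) :
    IsSelfAdjoint (Q.compLpL 2 μ) := by
  refine ContinuousLinearMap.isSelfAdjoint_iff_isSymmetric.2 fun f g => ?_
  change inner ℂ (Q.compLp f) g = inner ℂ f (Q.compLp g)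
  rw [L2.inner_def, L2.inner_def]
  refine integral_congr_ae ?_
  filter_upwards [Q.coeFn_compLp f, Q.coeFn_compLp g] with t h1 h2
  rw [h1, h2]
  exact hQ.isSymmetric.apply_clm _ _

/-- The bounded self-adjoint operator on the space of processes that represents the cost. -/
def FormData.costOperator (F : FormData Hα Ξ) :
    ProcessSpace Hα Ξ →L[ℂ] ProcessSpace Hα Ξ :=
  let p₁ := WithLp.fstL 2 ℂ (L2Half Hα) (L2Half Ξ)
  let p₂ := WithLp.sndL 2 ℂ (L2Half Hα) (L2Half Ξ)
  let C₁ := F.F₁.compLpL 2 (volume.restrict (Ioi (0 : ℝ)))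
  let C₂ := F.F₂.compLpL 2 (volume.restrict (Ioi (0 : ℝ)))
  let C₃ := F.F₃.compLpL 2 (volume.restrict (Ioi (0 : ℝ)))
  (p₁.adjoint ∘L C₁ ∘L p₁) + (p₂.adjoint ∘L C₂ ∘L p₁ + p₁.adjoint ∘L C₂.adjoint ∘L p₂)
    + (p₂.adjoint ∘L C₃ ∘L p₂)

theorem FormData.isSelfAdjoint_costOperator : IsSelfAdjoint F.costOperator := by
  rw [ContinuousLinearMap.isSelfAdjoint_iff']
  have h1 := ContinuousLinearMap.isSelfAdjoint_iff'.1
    (isSelfAdjoint_compLpL (μ := volume.restrict (Ioi (0 : ℝ))) F.selfAdjoint₁)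
  have h3 := ContinuousLinearMap.isSelfAdjoint_iff'.1
    (isSelfAdjoint_compLpL (μ := volume.restrict (Ioi (0 : ℝ))) F.selfAdjoint₃)
  simp only [FormData.costOperator, map_add, ContinuousLinearMap.adjoint_comp, h1, h3,
    ContinuousLinearMap.adjoint_adjoint, ContinuousLinearMap.comp_assoc]
  abel

theorem FormData.cost_eq (z : ProcessSpace Hα Ξ) :
    F.cost z = (inner ℂ (F.costOperator z) z).re := by
  have h := F.integral_form z.fst z.snd
  rw [FormData.cost, h]
  simp only [FormData.costOperator, _root_.add_apply, ContinuousLinearMap.comp_apply,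
    inner_add_left, ContinuousLinearMap.adjoint_inner_left, Complex.add_re]
  change _ = (inner ℂ (F.F₁.compLp z.fst) z.fst).re + ((inner ℂ (F.F₂.compLp z.fst) z.snd).re
    + (inner ℂ z.snd (F.F₂.compLp z.fst)).re) + (inner ℂ (F.F₃.compLp z.snd) z.snd).re
  have h2 : (inner ℂ z.snd (F.F₂.compLp z.fst)).re = (inner ℂ (F.F₂.compLp z.fst) z.snd).re :=
    inner_re_symm (𝕜 := ℂ) _ _
  rw [h2]
  ring

/-- The form `F(v, ξ) - c (|v|² + |ξ|²)`. -/
def FormData.shift (F : FormData Hα Ξ) (c : ℝ) : FormData Hα Ξ where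
  F₁ := F.F₁ - (c : ℂ) • ContinuousLinearMap.id ℂ Hα
  F₂ := F.F₂
  F₃ := F.F₃ - (c : ℂ) • ContinuousLinearMap.id ℂ Ξ
  selfAdjoint₁ := F.selfAdjoint₁.sub
    (IsSelfAdjoint.smul (by simp [isSelfAdjoint_iff]) (IsSelfAdjoint.one (Hα →L[ℂ] Hα)))
  selfAdjoint₃ := F.selfAdjoint₃.sub
    (IsSelfAdjoint.smul (by simp [isSelfAdjoint_iff]) (IsSelfAdjoint.one (Ξ →L[ℂ] Ξ)))

theorem FormData.shift_form (c : ℝ) (v : Hα) (ξ : Ξ) :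
    (F.shift c).form v ξ = F.form v ξ - c * (‖v‖ ^ 2 + ‖ξ‖ ^ 2) := by
  have h1 : (inner ℂ v v).re = ‖v‖ ^ 2 := (norm_sq_eq_re_inner (𝕜 := ℂ) v).symm
  have h2 : (inner ℂ ξ ξ).re = ‖ξ‖ ^ 2 := (norm_sq_eq_re_inner (𝕜 := ℂ) ξ).symm
  simp only [FormData.form, FormData.shift, _root_.sub_apply,
    _root_.smul_apply, ContinuousLinearMap.id_apply, inner_sub_left, inner_smul_left,
    Complex.conj_ofReal, Complex.sub_re, Complex.re_ofReal_mul, h1, h2]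
  ring

theorem FormData.shift_cost (c : ℝ) (z : ProcessSpace Hα Ξ) :
    (F.shift c).cost z = F.cost z - c * (‖z.fst‖ ^ 2 + ‖z.snd‖ ^ 2) := by
  have h1 := integrable_re_inner_of_memLp (Lp.memLp z.fst) (Lp.memLp z.fst)
  have h2 := integrable_re_inner_of_memLp (Lp.memLp z.snd) (Lp.memLp z.snd)
  rw [norm_sq_eq_integral z.fst, norm_sq_eq_integral z.snd, ← integral_add h1 h2,
    ← integral_const_mul, FormData.cost, FormData.cost,
    ← integral_sub (F.integrable_form (Lp.memLp z.fst) (Lp.memLp z.snd))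
      (by exact (h1.add h2).const_mul c)]
  refine integral_congr_ae (Eventually.of_forall fun t => ?_)
  have h1 : (inner ℂ (z.fst t) (z.fst t)).re = ‖z.fst t‖ ^ 2 :=
    (norm_sq_eq_re_inner (𝕜 := ℂ) _).symm
  have h2 : (inner ℂ (z.snd t) (z.snd t)).re = ‖z.snd t‖ ^ 2 :=
    (norm_sq_eq_re_inner (𝕜 := ℂ) _).symm
  simp only [F.shift_form, h1, h2]

end Forms

/-! ### The relation between initial states and processes -/

section Processes

variable {H Hα Ξ : Type*}
  [NormedAddCommGroup H] [InnerProductSpace ℂ H]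
  [NormedAddCommGroup Hα] [InnerProductSpace ℂ Hα]
  [NormedAddCommGroup Ξ] [InnerProductSpace ℂ Ξ]
  {G : C0Semigroup H} {B : Ξ →L[ℂ] H} {ι : Hα →L[ℂ] H}

theorem isOptimalProcess_iff_eq [CompleteSpace Hα] [CompleteSpace Ξ] {F : FormData Hα Ξ}
    {c : ℝ} (hc : 0 < c) {v₀ : Hα} {z₀ : ProcessSpace Hα Ξ} (h₀ : z₀ ∈ processes G B ι v₀)
    (h : ∀ z ∈ processes G B ι v₀, F.cost z₀ + c * ‖z - z₀‖ ^ 2 ≤ F.cost z)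
    (z : ProcessSpace Hα Ξ) : IsOptimalProcess G B ι F v₀ z ↔ z = z₀ := by
  constructor
  · rintro ⟨hz, hmin⟩
    have h1 := h z hz
    have h2 : F.cost z ≤ F.cost z₀ := hmin h₀
    have h3 : ‖z - z₀‖ ^ 2 ≤ 0 := nonpos_of_mul_nonpos_right (by linarith) hc
    exact sub_eq_zero.1 (norm_eq_zero.1
      (pow_eq_zero_iff two_ne_zero |>.1 (le_antisymm h3 (sq_nonneg _))))
  · rintro rfl
    refine ⟨h₀, fun w hw => ?_⟩
    have := h w hw
    have h3 : 0 ≤ c * ‖w - z‖ ^ 2 := by positivity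
    simp only [mem_ofPred_eq]
    linarith

variable [CompleteSpace H] (G B ι)

/-- The pairs of an initial state and a process through it. -/
def processRelation : Submodule ℂ (Hα × ProcessSpace Hα Ξ) where
  carrier := {p | p.2 ∈ processes G B ι p.1}
  add_mem' := by
    rintro ⟨x, z⟩ ⟨y, w⟩ hz hw
    simp only [processes, mem_ofPred_eq] at hz hw ⊢
    filter_upwards [hz, hw, Lp.coeFn_add z.fst w.fst, ae_restrict_mem measurableSet_Ioi]
      with t h1 h2 h3 ht
    obtain ⟨Φ, hΦ⟩ := exists_mildSolution_clm G B (le_of_lt ht : 0 ≤ t)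
    rw [← hΦ] at h1 h2 ⊢
    rw [Prod.fst_add, Prod.snd_add, WithLp.add_fst, WithLp.add_snd, h3, Pi.add_apply, map_add,
      h1, h2, ← map_add, map_add ι]
    rfl
  zero_mem' := by
    simp only [processes, mem_ofPred_eq]
    filter_upwards [Lp.coeFn_zero Hα 2 (volume.restrict (Ioi (0 : ℝ))),
      ae_restrict_mem measurableSet_Ioi] with t h3 ht
    obtain ⟨Φ, hΦ⟩ := exists_mildSolution_clm G B (le_of_lt ht : 0 ≤ t)
    rw [← hΦ, Prod.fst_zero, Prod.snd_zero, WithLp.zero_fst, WithLp.zero_snd, h3, Pi.zero_apply,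
      map_zero, ← Prod.zero_eq_mk, map_zero]
  smul_mem' := by
    rintro c ⟨x, z⟩ hz
    simp only [processes, mem_ofPred_eq] at hz ⊢
    filter_upwards [hz, Lp.coeFn_smul c z.fst, ae_restrict_mem measurableSet_Ioi]
      with t h1 h3 ht
    obtain ⟨Φ, hΦ⟩ := exists_mildSolution_clm G B (le_of_lt ht : 0 ≤ t)
    rw [← hΦ] at h1 ⊢
    rw [Prod.smul_fst, Prod.smul_snd, WithLp.smul_fst, WithLp.smul_snd, h3, Pi.smul_apply,
      map_smul, h1, ← map_smul, map_smul ι]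
    rfl

theorem isClosed_processRelation :
    IsClosed (processRelation G B ι : Set (Hα × ProcessSpace Hα Ξ)) := by
  -- An `L²` limit of trajectories is a pointwise limit almost everywhere on a subsequence, and the
  -- mild solution at a fixed time depends continuously on the initial state and the control.
  refine IsSeqClosed.isClosed fun p q hp hpq => ?_
  have hfst : Tendsto (fun n => (p n).2.fst) atTop (𝓝 q.2.fst) :=
    ((WithLp.fstL 2 ℂ (L2Half Hα) (L2Half Ξ)).continuous.tendsto _).comp
      ((continuous_snd.tendsto q).comp hpq)
  have hsnd : Tendsto (fun n => (p n).2.snd) atTop (𝓝 q.2.snd) :=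
    ((WithLp.sndL 2 ℂ (L2Half Hα) (L2Half Ξ)).continuous.tendsto _).comp
      ((continuous_snd.tendsto q).comp hpq)
  have hx : Tendsto (fun n => ι (p n).1) atTop (𝓝 (ι q.1)) :=
    (ι.continuous.tendsto _).comp ((continuous_fst.tendsto q).comp hpq)
  obtain ⟨ns, hns, hae⟩ := (tendstoInMeasure_of_tendsto_Lp hfst).exists_seq_tendsto_ae
  change q.2 ∈ processes G B ι q.1
  simp only [processes, mem_ofPred_eq]
  have hall : ∀ᵐ t ∂(volume.restrict (Ioi (0 : ℝ))), ∀ n,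
      ι ((p n).2.fst t) = mildSolution G B (ι (p n).1) (p n).2.snd t :=
    ae_all_iff.2 fun n => hp n
  filter_upwards [hae, hall, ae_restrict_mem measurableSet_Ioi] with t h1 h2 ht
  obtain ⟨Φ, hΦ⟩ := exists_mildSolution_clm G B (le_of_lt ht : 0 ≤ t)
  have h3 : Tendsto (fun k => ι ((p (ns k)).2.fst t)) atTop (𝓝 (ι (q.2.fst t))) :=
    (ι.continuous.tendsto _).comp h1
  have h4 : Tendsto (fun k => Φ (ι (p (ns k)).1, (p (ns k)).2.snd)) atTop
      (𝓝 (Φ (ι q.1, q.2.snd))) :=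
    (Φ.continuous.tendsto _).comp
      ((hx.comp hns.tendsto_atTop).prodMk_nhds (hsnd.comp hns.tendsto_atTop))
  rw [← hΦ]
  refine tendsto_nhds_unique (h3.congr fun k => ?_) h4
  rw [h2, hΦ]

theorem measurePreserving_sub_Ioi (T : ℝ) :
    MeasurePreserving (fun t : ℝ => t - T) (volume.restrict (Ioi T))
      (volume.restrict (Ioi (0 : ℝ))) := by
  have := (measurePreserving_sub_right (volume : Measure ℝ) T).restrict_preimage
    (measurableSet_Ioi (a := (0 : ℝ)))
  have e : (fun t : ℝ => t - T) ⁻¹' Ioi 0 = Ioi T := by ext; simp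
  rwa [e] at this

theorem memLp_of_continuousOn_Icc {E : Type*} [NormedAddCommGroup E] {T : ℝ} {v : ℝ → E}
    (hv : ContinuousOn v (Icc 0 T)) : MemLp v 2 (volume.restrict (Ioc 0 T)) := by
  obtain ⟨C, hC⟩ := isCompact_Icc.exists_bound_of_continuousOn hv
  refine MemLp.of_bound ((hv.mono Ioc_subset_Icc_self).aestronglyMeasurable measurableSet_Ioc) C ?_
  filter_upwards [ae_restrict_mem measurableSet_Ioc] with t ht
  exact hC t (Ioc_subset_Icc_self ht)

theorem memLp_concat {E : Type*} [NormedAddCommGroup E] {T : ℝ} (hT : 0 ≤ T) {f g : ℝ → E}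
    (hf : MemLp f 2 (volume.restrict (Ioc 0 T))) (hg : MemLp g 2 (volume.restrict (Ioi (0 : ℝ)))) :
    MemLp ((Iic T).piecewise f (fun t => g (t - T))) 2 (volume.restrict (Ioi (0 : ℝ))) := by
  refine MemLp.piecewise measurableSet_Iic ?_ ?_
  · rw [Measure.restrict_restrict measurableSet_Iic, inter_comm, Ioi_inter_Iic]
    exact hf
  · rw [compl_Iic, Measure.restrict_restrict measurableSet_Ioi, Ioi_inter_Ioi, max_eq_left hT]
    exact hg.comp_measurePreserving (measurePreserving_sub_Ioi T)

variable {G B ι}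

/-- A continuous trajectory on `[0, T]` followed by a process through its end point is a process,
and the costs add up. -/
theorem exists_concat_process [CompleteSpace Hα] [CompleteSpace Ξ] {T : ℝ} (hT : 0 ≤ T) {v₀ : Hα}
    {ξ : ℝ → Ξ} {v : ℝ → Hα}
    (hξ : MemLp ξ 2 (volume.restrict (Ioc 0 T))) (hv : ContinuousOn v (Icc 0 T))
    (hm : ∀ t ∈ Icc 0 T, ι (v t) = mildSolution G B (ι v₀) ξ t) {z : ProcessSpace Hα Ξ}
    (hz : z ∈ processes G B ι (v T)) (F : FormData Hα Ξ) :
    ∃ w ∈ processes G B ι v₀, F.cost w = (∫ t in (0 : ℝ)..T, F.form (v t) (ξ t)) + F.cost z := by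
  have hv2 : MemLp v 2 (volume.restrict (Ioc 0 T)) :=
    memLp_of_continuousOn_Icc hv
  have hvg := memLp_concat hT hv2 (Lp.memLp z.fst)
  have hξg := memLp_concat hT hξ (Lp.memLp z.snd)
  set vg := (Iic T).piecewise v (fun t => z.fst (t - T)) with hvg_def
  set ξg := (Iic T).piecewise ξ (fun t => z.snd (t - T)) with hξg_def
  have vg1 : ∀ t, t ≤ T → vg t = v t := fun t ht => piecewise_eq_of_mem _ _ _ ht
  have vg2 : ∀ t, T < t → vg t = z.fst (t - T) := fun t ht =>
    piecewise_eq_of_notMem _ _ _ (notMem_Iic.2 ht)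
  have ξg1 : ∀ t, t ≤ T → ξg t = ξ t := fun t ht => piecewise_eq_of_mem _ _ _ ht
  have ξg2 : ∀ t, T < t → ξg t = z.snd (t - T) := fun t ht =>
    piecewise_eq_of_notMem _ _ _ (notMem_Iic.2 ht)
  have hIoi : Ioc 0 T ∪ Ioi T = Ioi (0 : ℝ) := Ioc_union_Ioi_eq_Ioi hT
  have hearly : ∀ t, 0 ≤ t → t ≤ T →
      mildSolution G B (ι v₀) ξg t = mildSolution G B (ι v₀) ξ t := fun t ht htT => by
    refine mildSolution_congr G B ht ?_
    filter_upwards [ae_restrict_mem measurableSet_Ioc] with s hs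
    exact ξg1 s (hs.2.trans htT)
  refine ⟨WithLp.toLp 2 (hvg.toLp vg, hξg.toLp ξg), ?_, ?_⟩
  · simp only [processes, mem_ofPred_eq]
    have hmain : ∀ᵐ t ∂(volume.restrict (Ioi (0 : ℝ))),
        ι (vg t) = mildSolution G B (ι v₀) ξg t := by
      rw [← hIoi, ae_restrict_union_iff]
      constructor
      · filter_upwards [ae_restrict_mem measurableSet_Ioc] with t ht
        rw [vg1 t ht.2, hearly t ht.1.le ht.2, hm t ⟨ht.1.le, ht.2⟩]
      · filter_upwards [(measurePreserving_sub_Ioi T).quasiMeasurePreserving.ae hz,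
          ae_restrict_mem measurableSet_Ioi] with t h1 ht
        have ht' : 0 ≤ t - T := sub_nonneg.2 (le_of_lt ht)
        have h2 := mildSolution_add_time G B (v₀ := ι v₀) (ξ := ξg) hT ht'
          (integrableOn_Ioc_of_memLp hξg)
        rw [add_sub_cancel] at h2
        rw [vg2 t ht, h1, h2, hearly T hT le_rfl, ← hm T ⟨hT, le_rfl⟩]
        refine mildSolution_congr G B ht' ?_
        filter_upwards [ae_restrict_mem measurableSet_Ioc] with s hs
        rw [ξg2 _ (by linarith [hs.1]), add_sub_cancel_left]
    filter_upwards [hmain, hvg.coeFn_toLp, ae_restrict_mem measurableSet_Ioi] with t h1 h2 ht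
    have h3 : mildSolution G B (ι v₀) (hξg.toLp ξg) t = mildSolution G B (ι v₀) ξg t :=
      mildSolution_congr G B (le_of_lt ht) (ae_restrict_of_ae_restrict_of_subset
        Ioc_subset_Ioi_self hξg.coeFn_toLp)
    change ι ((hvg.toLp vg) t) = mildSolution G B (ι v₀) (hξg.toLp ξg) t
    rw [h3, h2, h1]
  · have e1 : F.cost (WithLp.toLp 2 (hvg.toLp vg, hξg.toLp ξg))
        = ∫ t in Ioi (0 : ℝ), F.form (vg t) (ξg t) := by
      refine integral_congr_ae ?_
      filter_upwards [hvg.coeFn_toLp, hξg.coeFn_toLp] with t h1 h2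
      change F.form ((hvg.toLp vg) t) ((hξg.toLp ξg) t) = _
      rw [h1, h2]
    have hint : IntegrableOn (fun t => F.form (vg t) (ξg t)) (Ioi 0) := F.integrable_form hvg hξg
    rw [e1, ← hIoi, setIntegral_union Ioc_disjoint_Ioi_same measurableSet_Ioi
      (hint.mono_set Ioc_subset_Ioi_self) (hint.mono_set (Ioi_subset_Ioi hT)),
      intervalIntegral.integral_of_le hT]
    congr 1
    · refine setIntegral_congr_fun measurableSet_Ioc fun t ht => ?_
      simp only [vg1 t ht.2, ξg1 t ht.2]
    · have := (measurePreserving_sub_Ioi T).integral_comp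
        (MeasurableEquiv.subRight T).measurableEmbedding (fun t => F.form (z.fst t) (z.snd t))
      rw [FormData.cost, ← this]
      refine setIntegral_congr_fun measurableSet_Ioi fun t ht => ?_
      simp only [vg2 t ht, ξg2 t ht]

variable [CompleteSpace Hα] [CompleteSpace Ξ]

/-- Optimal processes exist and depend linearly and continuously on the initial state. -/
theorem exists_optimal_clm (hCONT : L2Controllable G B ι) {F : FormData Hα Ξ} {c : ℝ} (hc : 0 < c)
    (hF : ∀ z ∈ processes G B ι 0, c * (‖z.fst‖ ^ 2 + ‖z.snd‖ ^ 2) ≤ F.cost z) :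
    ∃ S : Hα →L[ℂ] ProcessSpace Hα Ξ, ∀ v₀, S v₀ ∈ processes G B ι v₀ ∧
      ∀ z ∈ processes G B ι v₀, F.cost (S v₀) + c * ‖z - S v₀‖ ^ 2 ≤ F.cost z := by
  obtain ⟨S, hS⟩ := exists_clm_minimizer F.isSelfAdjoint_costOperator
    (isClosed_processRelation G B ι)
    (fun v₀ => by
      obtain ⟨ξ, v, h⟩ := hCONT v₀
      exact ⟨WithLp.toLp 2 (v, ξ), h⟩) hc
    (fun m hm => by
      rw [← F.cost_eq, WithLp.prod_norm_sq_eq_of_L2]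
      exact hF m hm)
  refine ⟨S, fun v₀ => ⟨(hS v₀).1, fun z hz => ?_⟩⟩
  rw [F.cost_eq, F.cost_eq]
  exact (hS v₀).2 z hz

/-- The value of the optimal cost is a bounded Hermitian form of the initial state. -/
theorem exists_cost_operator (F : FormData Hα Ξ) (S : Hα →L[ℂ] ProcessSpace Hα Ξ) :
    ∃ P : Hα →L[ℂ] Hα, IsSelfAdjoint P ∧ ∀ v₀, inner ℂ (P v₀) v₀ = (F.cost (S v₀) : ℂ) := by
  have hP : IsSelfAdjoint (S.adjoint ∘L F.costOperator ∘L S) :=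
    F.isSelfAdjoint_costOperator.adjoint_conj S
  refine ⟨_, hP, fun v₀ => ?_⟩
  have h1 : inner ℂ ((S.adjoint ∘L F.costOperator ∘L S) v₀) v₀
      = inner ℂ (F.costOperator (S v₀)) (S v₀) := by
    simp only [ContinuousLinearMap.comp_apply, ContinuousLinearMap.adjoint_inner_left]
  rw [h1, F.cost_eq]
  exact (hP.isSymmetric.coe_re_inner_apply_self v₀ |> fun h => by rw [← h1]; exact h.symm)

/-- Dynamic programming: optimality of `S v₀` yields the dissipation inequality for the optimal
cost. -/
theorem dissipation_inequality {F : FormData Hα Ξ} {S : Hα → ProcessSpace Hα Ξ}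
    (hS : ∀ v₀, IsOptimalProcess G B ι F v₀ (S v₀)) {T : ℝ} (hT : 0 ≤ T) {v₀ : Hα}
    {ξ : ℝ → Ξ} {v : ℝ → Hα} (hξ : MemLp ξ 2 (volume.restrict (Ioc 0 T)))
    (hv : ContinuousOn v (Icc 0 T))
    (hm : ∀ t ∈ Icc 0 T, ι (v t) = mildSolution G B (ι v₀) ξ t) :
    0 ≤ F.cost (S (v T)) - F.cost (S v₀) + ∫ t in (0 : ℝ)..T, F.form (v t) (ξ t) := by
  obtain ⟨w, hw, hcost⟩ := exists_concat_process hT hξ hv hm (hS (v T)).1 F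
  have : F.cost (S v₀) ≤ F.cost w := (hS v₀).2 hw
  linarith

end Processes

/-! ### The Laplace transform of the variation of constants formula -/

section Laplace

variable {H Ξ : Type*}
  [NormedAddCommGroup H] [InnerProductSpace ℂ H]
  [NormedAddCommGroup Ξ] [InnerProductSpace ℂ Ξ]

/-- The trajectory of the control `ξ` started from `0` in the remote past: the convolution
`∫ G(t - s) B ξ(s) ds` over `s ≤ t`. -/
def pastConvolution (G : C0Semigroup H) (B : Ξ →L[ℂ] H) (ξ : ℝ → Ξ) (t : ℝ) : H :=
  ∫ s in Iic t, G.toFun (t - s) (B (ξ s))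

theorem pastConvolution_eq_mildSolution (G : C0Semigroup H) (B : Ξ →L[ℂ] H) {ξ : ℝ → Ξ}
    (hξ0 : ∀ t ≤ 0, ξ t = 0) {t : ℝ} (ht : 0 ≤ t) :
    pastConvolution G B ξ t = mildSolution G B 0 ξ t := by
  rw [mildSolution, map_zero, zero_add, intervalIntegral.integral_of_le ht, pastConvolution]
  refine setIntegral_eq_of_subset_of_forall_sdiff_eq_zero measurableSet_Iic Ioc_subset_Iic_self
    fun s hs => ?_
  rw [hξ0 s (not_lt.1 fun h => hs.2 ⟨h, hs.1⟩), map_zero, map_zero]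

theorem pastConvolution_of_nonpos (G : C0Semigroup H) (B : Ξ →L[ℂ] H) {ξ : ℝ → Ξ}
    (hξ0 : ∀ t ≤ 0, ξ t = 0) {t : ℝ} (ht : t ≤ 0) :
    pastConvolution G B ξ t = 0 := by
  refine setIntegral_eq_zero_of_forall_eq_zero fun s hs => ?_
  rw [hξ0 s (le_trans hs ht), map_zero, map_zero]

variable [CompleteSpace H] (G : C0Semigroup H) (B : Ξ →L[ℂ] H)

/-- The variation of constants formula between the times `t` and `t + h`. -/
theorem pastConvolution_add {ξ : ℝ → Ξ} (hξ0 : ∀ t ≤ 0, ξ t = 0)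
    (hξ : ∀ t, IntegrableOn ξ (Ioc 0 t)) (t : ℝ) {h : ℝ} (hh : 0 ≤ h) :
    pastConvolution G B ξ (t + h) = G.toFun h (pastConvolution G B ξ t)
      + ∫ r in Ioc 0 h, G.toFun r (B (ξ (t + h - r))) := by
  have hint : ∀ t, IntegrableOn (fun s => G.toFun (t - s) (B (ξ s))) (Iic t) := fun t => by
    have h1 : IntegrableOn (fun s => G.toFun (t - s) (B (ξ s))) (Iic 0) :=
      (integrableOn_zero (s := Iic (0 : ℝ))).congr_fun
        (fun s hs => by simp only [hξ0 s hs, map_zero]) measurableSet_Iic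
    refine (h1.union (integrableOn_convolution G B (hξ t))).mono_set fun s hs => ?_
    rcases le_or_gt s 0 with h | h
    · exact Or.inl h
    · exact Or.inr ⟨h, hs⟩
  have hsplit : Iic (t + h) = Iic t ∪ Ioc t (t + h) :=
    (Iic_union_Ioc_eq_Iic (by linarith)).symm
  have hdisj : Disjoint (Iic t) (Ioc t (t + h)) :=
    Set.disjoint_left.2 fun s hs hs' => absurd hs'.1 (not_lt.2 hs)
  have hi := hint (t + h)
  rw [hsplit] at hi
  unfold pastConvolution
  rw [hsplit, setIntegral_union hdisj measurableSet_Ioc hi.left_of_union hi.right_of_union]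
  congr 1
  · rw [← (G.toFun h).integral_comp_comm (hint t)]
    refine setIntegral_congr_fun measurableSet_Iic fun s hs => ?_
    have hs' : 0 ≤ t - s := sub_nonneg.2 hs
    rw [show t + h - s = h + (t - s) by ring, G.map_add h (t - s) hh hs']
    rfl
  · rw [← intervalIntegral.integral_of_le (by linarith), ← intervalIntegral.integral_of_le hh]
    have := intervalIntegral.integral_comp_sub_left (a := 0) (b := h)
      (fun s => G.toFun (t + h - s) (B (ξ s))) (t + h)
    rw [sub_zero, add_sub_cancel_right] at this
    rw [← this]
    simp only [sub_sub_cancel]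

theorem integrable_translates {E : Type*} [NormedAddCommGroup E] {η : ℝ → E}
    (hη : StronglyMeasurable η) (hi : Integrable η) (h : ℝ) :
    Integrable (fun q : ℝ × ℝ => η (q.1 + h - q.2))
      (volume.prod (volume.restrict (Ioc 0 h))) := by
  have hm : StronglyMeasurable fun q : ℝ × ℝ => η (q.1 + h - q.2) :=
    hη.comp_measurable (by fun_prop)
  rw [integrable_prod_iff' hm.aestronglyMeasurable]
  have e : ∀ r : ℝ, (fun t => η (t + h - r)) = fun t => η (t + (h - r)) := fun r => by
    ext t; rw [add_sub_assoc]
  refine ⟨Eventually.of_forall fun r => ?_, ?_⟩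
  · simp only
    rw [e r]
    exact hi.comp_add_right (h - r)
  · have : (fun r : ℝ => ∫ t, ‖η (t + h - r)‖) = fun _ => ∫ t, ‖η t‖ := by
      ext r
      simp only [add_sub_assoc]
      exact integral_add_right_eq_self (fun t => ‖η t‖) (h - r)
    simp only
    rw [this]
    exact integrable_const _

/-- The Laplace transform `p ↦ ∫ e^{-p t} f(t) dt` over the whole line. -/
def laplace {E : Type*} [NormedAddCommGroup E] [NormedSpace ℂ E] (p : ℂ) (f : ℝ → E) : E :=
  ∫ t : ℝ, Complex.exp (-p * t) • f t

/-- If `e^{μ t} x` is the mild solution of `v' = A v + e^{μ t} y` for `t ≥ 0`, then `x ∈ D(A)` and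
`μ x = A x + y`: by the integral equation `t ↦ G(t) x` is right differentiable at `0`. -/
theorem exists_mem_domain_of_integral_eq {A : H →ₗ.[ℂ] H} (hA : IsGenerator A G) {μ : ℂ} {x y : H}
    (hxy : ∀ h : ℝ, 0 ≤ h → Complex.exp (μ * h) • x
      = G.toFun h x + ∫ r in (0 : ℝ)..h, Complex.exp (μ * (h - r)) • G.toFun (max r 0) y) :
    ∃ hx : x ∈ A.domain, μ • x = A ⟨x, hx⟩ + y := by
  have hexp : ∀ r : ℝ, HasDerivAt (fun r : ℝ => Complex.exp (μ * r))
      (Complex.exp (μ * r) * μ) r := by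
    intro r
    have h1 : HasDerivAt (fun r : ℝ => μ * (r : ℂ)) (μ * 1) r :=
      (Complex.ofRealCLM.hasDerivAt (x := r)).const_mul _
    rw [mul_one] at h1
    exact h1.cexp
  -- The integral equation reads `φ(h) = G(h) x` for `h ≥ 0`, and `φ'(0) = μ x - y`.
  let ψ : ℝ → H := fun r => Complex.exp (-μ * r) • G.toFun (max r 0) y
  have hψ : Continuous ψ :=
    (by fun_prop : Continuous fun r : ℝ => Complex.exp (-μ * r)).smul
      (G.continuous_uncurry.comp (continuous_id.prodMk continuous_const))
  let φ : ℝ → H := fun h => Complex.exp (μ * h) • (x - ∫ r in (0 : ℝ)..h, ψ r)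
  have hφ : HasDerivAt φ (μ • x - y) 0 := by
    have h1 := (hexp 0).smul ((hasDerivAt_const (0 : ℝ) x).sub
      (intervalIntegral.integral_hasDerivAt_right (hψ.intervalIntegrable 0 0)
        (hψ.stronglyMeasurableAtFilter _ _) hψ.continuousAt))
    refine h1.congr_deriv ?_
    simp [ψ, G.map_zero]
    abel
  have hφ0 : φ 0 = x := by simp [φ]
  have hφG : ∀ h : ℝ, 0 ≤ h → φ h = G.toFun h x := fun h hh => by
    have : ∫ r in (0 : ℝ)..h, Complex.exp (μ * (h - r)) • G.toFun (max r 0) y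
        = Complex.exp (μ * h) • ∫ r in (0 : ℝ)..h, ψ r := by
      rw [← intervalIntegral.integral_smul]
      refine intervalIntegral.integral_congr fun r _ => ?_
      simp only [ψ, smul_smul, ← Complex.exp_add]
      congr 2
      ring
    have h2 := hxy h hh
    rw [this] at h2
    simp only [φ, smul_sub]
    rw [h2, add_sub_cancel_right]
  have hlim : Tendsto (fun t : ℝ => ((t⁻¹ : ℝ) : ℂ) • (G.toFun t x - x)) (𝓝[>] (0 : ℝ))
      (𝓝 (μ • x - y)) := by
    have h1 := (hasDerivWithinAt_iff_tendsto_slope' (lt_irrefl (0 : ℝ))).1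
      (hφ.hasDerivWithinAt (s := Ioi 0))
    refine h1.congr' ?_
    filter_upwards [self_mem_nhdsWithin] with t ht
    rw [slope_def_module, hφ0, hφG t (le_of_lt ht), sub_zero, Complex.coe_smul]
  obtain ⟨hx, hAx⟩ := (hA x (μ • x - y)).2 hlim
  exact ⟨hx, by rw [hAx]; abel⟩

variable [CompleteSpace Ξ]

/-- The Laplace transform of the variation of constants formula. -/
theorem laplace_pastConvolution {ξ : ℝ → Ξ} (hξ0 : ∀ t ≤ 0, ξ t = 0)
    (hξ : ∀ t, IntegrableOn ξ (Ioc 0 t)) (hξm : StronglyMeasurable ξ) {p : ℂ}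
    (hξp : Integrable fun t : ℝ => Complex.exp (-p * t) • ξ t)
    (hmp : Integrable fun t : ℝ => Complex.exp (-p * t) • pastConvolution G B ξ t)
    {h : ℝ} (hh : 0 ≤ h) :
    Complex.exp (p * h) • laplace p (pastConvolution G B ξ)
      = G.toFun h (laplace p (pastConvolution G B ξ))
        + ∫ r in (0 : ℝ)..h, Complex.exp (p * (h - r)) • G.toFun (max r 0) (B (laplace p ξ)) := by
  set m := pastConvolution G B ξ with hm_def
  set η : ℝ → Ξ := fun t => Complex.exp (-p * t) • ξ t with hη_def
  have hηm : StronglyMeasurable η :=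
    (by fun_prop : Continuous fun t : ℝ => Complex.exp (-p * t)).stronglyMeasurable.smul hξm
  -- `Ψ t r` equals `e^{-p t} G(r) B ξ(t + h - r)`; writing it in terms of the integrable function
  -- `η` isolates the translate `η (t + h - r)`, to which Fubini's theorem applies.
  let Ψ : ℝ → ℝ → H := fun t r =>
    Complex.exp (p * (h - r)) • G.toFun (max r 0) (B (η (t + h - r)))
  have hΨ : Integrable (Function.uncurry Ψ) (volume.prod (volume.restrict (Ioc 0 h))) := by
    obtain ⟨M, hM0, hM⟩ := G.exists_norm_le h
    obtain ⟨C, hC⟩ := (isCompact_Icc (a := (0 : ℝ)) (b := h)).exists_bound_of_continuousOn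
      (f := fun r : ℝ => Complex.exp (p * (h - r))) (by fun_prop)
    refine Integrable.mono' ((integrable_translates hηm hξp h).norm.const_mul (C * (M * ‖B‖)))
      ?_ ?_
    · have h1 : StronglyMeasurable fun q : ℝ × ℝ => B (η (q.1 + h - q.2)) :=
        B.continuous.comp_stronglyMeasurable (hηm.comp_measurable (by fun_prop))
      have h2 : AEStronglyMeasurable (fun q : ℝ × ℝ => G.toFun (max q.2 0) (B (η (q.1 + h - q.2))))
          (volume.prod (volume.restrict (Ioc 0 h))) :=
        G.continuous_uncurry.comp_aestronglyMeasurable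
          (continuous_snd.aestronglyMeasurable.prodMk h1.aestronglyMeasurable)
      exact (by fun_prop : Continuous fun q : ℝ × ℝ =>
        Complex.exp (p * (h - q.2))).aestronglyMeasurable.smul h2
    · have hae : ∀ᵐ q : ℝ × ℝ ∂(volume.prod (volume.restrict (Ioc 0 h))), q.2 ∈ Ioc 0 h :=
        Measure.quasiMeasurePreserving_snd.ae (ae_restrict_mem measurableSet_Ioc)
      filter_upwards [hae] with q hq
      have hq' : max q.2 0 ∈ Icc 0 h := by rw [max_eq_left hq.1.le]; exact ⟨hq.1.le, hq.2⟩
      calc ‖Function.uncurry Ψ q‖ = ‖Complex.exp (p * (h - q.2))‖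
            * ‖G.toFun (max q.2 0) (B (η (q.1 + h - q.2)))‖ := norm_smul _ _
        _ ≤ C * (M * (‖B‖ * ‖η (q.1 + h - q.2)‖)) := by
            have h0 := hC q.2 (Ioc_subset_Icc_self hq)
            have hC0 : 0 ≤ C := (norm_nonneg _).trans h0
            gcongr
            exact ((G.toFun _).le_opNorm _).trans
              (mul_le_mul (hM _ hq') (B.le_opNorm _) (norm_nonneg _) hM0)
        _ = _ := by ring
  -- The weighted variation of constants formula.
  have hpt : ∀ t : ℝ, Complex.exp (p * h) • Complex.exp (-p * (t + h : ℝ)) • m (t + h)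
      = G.toFun h (Complex.exp (-p * t) • m t) + ∫ r in Ioc 0 h, Ψ t r := fun t => by
    have e1 : Complex.exp (p * h) * Complex.exp (-p * (t + h : ℝ)) = Complex.exp (-p * t) := by
      rw [← Complex.exp_add]; congr 1; push_cast; ring
    rw [smul_smul, e1, hm_def, pastConvolution_add G B hξ0 hξ t hh, smul_add, map_smul,
      ← integral_smul]
    congr 1
    refine setIntegral_congr_fun measurableSet_Ioc fun r hr => ?_
    simp only [Ψ, η, map_smul, smul_smul, max_eq_left hr.1.le]
    rw [← Complex.exp_add]
    congr 2
    push_cast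
    ring
  have hG : Integrable fun t : ℝ => G.toFun h (Complex.exp (-p * t) • m t) :=
    (G.toFun h).integrable_comp hmp
  calc Complex.exp (p * h) • laplace p m
      = Complex.exp (p * h) • ∫ t : ℝ, Complex.exp (-p * (t + h : ℝ)) • m (t + h) := by
        rw [laplace, integral_add_right_eq_self (fun t : ℝ => Complex.exp (-p * t) • m t) h]
    _ = ∫ t : ℝ, (G.toFun h (Complex.exp (-p * t) • m t) + ∫ r in Ioc 0 h, Ψ t r) := by
        rw [← integral_smul]
        exact integral_congr_ae (Eventually.of_forall hpt)
    _ = (∫ t : ℝ, G.toFun h (Complex.exp (-p * t) • m t)) + ∫ t : ℝ, ∫ r in Ioc 0 h, Ψ t r :=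
        integral_add hG hΨ.integral_prod_left
    _ = G.toFun h (laplace p m) + ∫ r in Ioc 0 h, ∫ t : ℝ, Ψ t r := by
        rw [(G.toFun h).integral_comp_comm hmp, integral_integral_swap hΨ]
        rfl
    _ = _ := by
        rw [intervalIntegral.integral_of_le hh]
        congr 1
        refine setIntegral_congr_fun measurableSet_Ioc fun r _ => ?_
        have hη' : Integrable fun t => η (t + (h - r)) := hξp.comp_add_right (h - r)
        have e2 : laplace p ξ = ∫ t, η (t + (h - r)) :=
          (integral_add_right_eq_self η (h - r)).symm
        simp only [Ψ, add_sub_assoc]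
        rw [integral_smul, e2]
        congr 1
        exact ((G.toFun (max r 0)).comp B).integral_comp_comm hη'

end Laplace

/-! ### Exponentially damped functions and their Fourier transforms -/

section Weights

open FourierTransform

variable {E : Type*} [NormedAddCommGroup E] [InnerProductSpace ℂ E] {f : ℝ → E}

theorem norm_exp_smul_le (hf0 : ∀ t ≤ 0, f t = 0) {p : ℂ} (hp : 0 ≤ p.re) (t : ℝ) :
    ‖Complex.exp (-p * t) • f t‖ ≤ ‖f t‖ := by
  rcases le_or_gt t 0 with h | h
  · simp [hf0 t h]
  · rw [norm_smul, Complex.norm_exp]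
    refine mul_le_of_le_one_left (norm_nonneg _) (Real.exp_le_one_iff.2 ?_)
    simp only [Complex.mul_re, Complex.neg_re, Complex.ofReal_re, Complex.ofReal_im, mul_zero,
      sub_zero]
    nlinarith

theorem aestronglyMeasurable_exp_smul (hf : AEStronglyMeasurable f) (p : ℂ) :
    AEStronglyMeasurable (fun t : ℝ => Complex.exp (-p * t) • f t) :=
  (by fun_prop : Continuous fun t : ℝ => Complex.exp (-p * t)).aestronglyMeasurable.smul hf

theorem memLp_exp_smul (hf0 : ∀ t ≤ 0, f t = 0) (hf : MemLp f 2) {p : ℂ} (hp : 0 ≤ p.re) :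
    MemLp (fun t : ℝ => Complex.exp (-p * t) • f t) 2 :=
  hf.mono (aestronglyMeasurable_exp_smul hf.1 p)
    (Eventually.of_forall (norm_exp_smul_le hf0 hp))

theorem integrable_exp_smul (hf0 : ∀ t ≤ 0, f t = 0) (hf : MemLp f 2) {p : ℂ} (hp : 0 < p.re) :
    Integrable (fun t : ℝ => Complex.exp (-p * t) • f t) := by
  -- `e^{-a t} |f| ≤ e^{-2 a t} + |f|²` on `t > 0`, with `a = Re p`.
  have h1 : Integrable ((Ioi (0 : ℝ)).indicator fun t => Real.exp (-(2 * p.re) * t)) :=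
    (integrable_indicator_iff measurableSet_Ioi).2 (exp_neg_integrableOn_Ioi 0 (by positivity))
  refine Integrable.mono' (h1.add (hf.integrable_norm_pow (by norm_num)))
    (aestronglyMeasurable_exp_smul hf.1 p) (Eventually.of_forall fun t => ?_)
  rcases le_or_gt t 0 with h | h
  · simp only [hf0 t h, smul_zero, norm_zero, Pi.add_apply]
    exact add_nonneg (indicator_nonneg (fun _ _ => (Real.exp_pos _).le) _) (by positivity)
  · rw [norm_smul, Complex.norm_exp, Pi.add_apply, indicator_of_mem (mem_Ioi.2 h)]
    have e : (-p * t).re = -p.re * t := by simp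
    have e2 : Real.exp (-(2 * p.re) * t) = Real.exp (-p.re * t) ^ 2 := by
      rw [← Real.exp_nat_mul]; congr 1; push_cast; ring
    rw [e, e2]
    nlinarith [sq_nonneg (Real.exp (-p.re * t) - ‖f t‖), Real.exp_pos (-p.re * t),
      norm_nonneg (f t), sq_nonneg (Real.exp (-p.re * t)), sq_nonneg ‖f t‖]

/-- Exponential damping converges to the identity in `L²`. -/
theorem tendsto_toLp_exp_smul (hf0 : ∀ t ≤ 0, f t = 0) (hf : MemLp f 2) {lam : ℕ → ℝ}
    (hlam : ∀ n, 0 ≤ (lam n : ℂ).re) (hlim : Tendsto lam atTop (𝓝 0)) :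
    Tendsto (fun n => (memLp_exp_smul hf0 hf (hlam n)).toLp) atTop (𝓝 (hf.toLp f)) := by
  rw [tendsto_iff_norm_sub_tendsto_zero]
  have hsq : Tendsto (fun n => ‖(memLp_exp_smul hf0 hf (hlam n)).toLp - hf.toLp f‖ ^ 2) atTop
      (𝓝 0) := by
    have e : ∀ n, ‖(memLp_exp_smul hf0 hf (hlam n)).toLp - hf.toLp f‖ ^ 2
        = ∫ t : ℝ, ‖Complex.exp (-(lam n : ℂ) * t) • f t - f t‖ ^ 2 := fun n => by
      rw [norm_sq_eq_integral]
      refine integral_congr_ae ?_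
      filter_upwards [Lp.coeFn_sub (memLp_exp_smul hf0 hf (hlam n)).toLp (hf.toLp f),
        (memLp_exp_smul hf0 hf (hlam n)).coeFn_toLp, hf.coeFn_toLp] with t h1 h2 h3
      rw [h1, Pi.sub_apply, h2, h3]
      exact (norm_sq_eq_re_inner (𝕜 := ℂ) _).symm
    simp only [e]
    have h0 : (0 : ℝ) = ∫ _t : ℝ, (0 : ℝ) := by simp
    rw [h0]
    refine tendsto_integral_of_dominated_convergence (fun t => (2 * ‖f t‖) ^ 2) (fun n => ?_) ?_
      (fun n => Eventually.of_forall fun t => ?_) (Eventually.of_forall fun t => ?_)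
    · exact ((aestronglyMeasurable_exp_smul hf.1 _).sub hf.1).norm.pow 2
    · have := (hf.integrable_norm_pow (by norm_num)).const_mul 4
      refine this.congr (Eventually.of_forall fun t => ?_)
      ring
    · rw [Real.norm_of_nonneg (by positivity)]
      have := norm_exp_smul_le hf0 (hlam n) t
      gcongr
      exact (norm_sub_le _ _).trans (by linarith)
    · have hc : Continuous fun l : ℝ => ‖Complex.exp (-(l : ℂ) * t) • f t - f t‖ ^ 2 := by fun_prop
      have := (hc.tendsto 0).comp hlim
      simpa [Function.comp_def] using this
  have := hsq.sqrt
  simpa [Real.sqrt_sq] using this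

/-- The Fourier transform of the damped function is the Laplace transform on a vertical line. -/
theorem fourier_exp_smul (lam x : ℝ) :
    𝓕 (fun t : ℝ => Complex.exp (-(lam : ℂ) * t) • f t) x
      = laplace (lam + Complex.I * (2 * Real.pi * x : ℝ)) f := by
  rw [Real.fourier_real_eq_integral_exp_smul, laplace]
  refine integral_congr_ae (Eventually.of_forall fun t => ?_)
  simp only [smul_smul, ← Complex.exp_add]
  congr 2
  push_cast
  ring

/-- On a subsequence, the Laplace transforms on the lines `Re p = lam n → 0` converge almost
everywhere to the `L²` Fourier transform. -/
theorem exists_subseq_laplace_tendsto [CompleteSpace E] (hf0 : ∀ t ≤ 0, f t = 0) (hf : MemLp f 2)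
    {lam : ℕ → ℝ} (hlam : ∀ n, 0 < lam n) (hlim : Tendsto lam atTop (𝓝 0)) :
    ∃ ns : ℕ → ℕ, StrictMono ns ∧ ∀ᵐ x : ℝ, Tendsto
      (fun k => laplace (lam (ns k) + Complex.I * (2 * Real.pi * x : ℝ)) f) atTop
      (𝓝 ((𝓕 (hf.toLp f) : Lp E 2 (volume : Measure ℝ)) x)) := by
  have hre : ∀ n, 0 ≤ (lam n : ℂ).re := fun n => (hlam n).le
  have h1 := tendsto_toLp_exp_smul hf0 hf hre hlim
  have h2 := ((Lp.fourierTransformₗᵢ ℝ E).continuous.tendsto _).comp h1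
  obtain ⟨ns, hns, hae⟩ := (tendstoInMeasure_of_tendsto_Lp h2).exists_seq_tendsto_ae
  refine ⟨ns, hns, ?_⟩
  have h3 : ∀ᵐ x : ℝ, ∀ n,
      (𝓕 ((memLp_exp_smul hf0 hf (hre n)).toLp) : Lp E 2 (volume : Measure ℝ)) x
        = laplace (lam n + Complex.I * (2 * Real.pi * x : ℝ)) f := by
    refine ae_all_iff.2 fun n => ?_
    filter_upwards [fourier_toLp_ae_eq (integrable_exp_smul hf0 hf (hlam n))
      (memLp_exp_smul hf0 hf (hre n))] with x hx
    rw [hx, fourier_exp_smul]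
  filter_upwards [hae, h3] with x hx1 hx3
  refine hx1.congr fun k => ?_
  exact hx3 (ns k)

end Weights

/-! ### The frequency domain representation of a process -/

section Frequency

open FourierTransform

variable {H Hα Ξ : Type*}
  [NormedAddCommGroup H] [InnerProductSpace ℂ H] [CompleteSpace H]
  [NormedAddCommGroup Hα] [InnerProductSpace ℂ Hα] [CompleteSpace Hα]
  [NormedAddCommGroup Ξ] [InnerProductSpace ℂ Ξ] [CompleteSpace Ξ]
  {G : C0Semigroup H} {A : H →ₗ.[ℂ] H} {B : Ξ →L[ℂ] H} {ι : Hα →L[ℂ] H}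

/-- The Fourier transform of a process through `0` solves `i ω v = A v + B ξ` at almost every
frequency, and the cost is the integral of the form over the frequencies. The frequency
is `ω = 2 π x`, in Mathlib's normalization of the Fourier transform. -/
theorem exists_frequency_representation (hA : IsGenerator A G) {z : ProcessSpace Hα Ξ}
    (hz : z ∈ processes G B ι 0) :
    ∃ (v : Lp Hα 2 (volume : Measure ℝ)) (ξ : Lp Ξ 2 (volume : Measure ℝ)),
      (∀ᵐ x : ℝ, ∃ h : ι (v x) ∈ A.domain,
        (Complex.I * (2 * Real.pi * x : ℝ)) • ι (v x) = A ⟨ι (v x), h⟩ + B (ξ x)) ∧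
      ∀ F : FormData Hα Ξ, F.cost z = ∫ x, F.form (v x) (ξ x) := by
  set f : ℝ → Hα := (Ioi (0 : ℝ)).indicator z.fst with hf_def
  set ξ : ℝ → Ξ := (Ioi (0 : ℝ)).indicator z.snd with hξ_def
  have hf : MemLp f 2 := (memLp_indicator_iff_restrict measurableSet_Ioi).2 (Lp.memLp z.fst)
  have hξ : MemLp ξ 2 := (memLp_indicator_iff_restrict measurableSet_Ioi).2 (Lp.memLp z.snd)
  have hf0 : ∀ t ≤ 0, f t = 0 := fun t ht => indicator_of_notMem (notMem_Ioi.2 ht) _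
  have hξ0 : ∀ t ≤ 0, ξ t = 0 := fun t ht => indicator_of_notMem (notMem_Ioi.2 ht) _
  have hξm : StronglyMeasurable ξ := (Lp.stronglyMeasurable z.snd).indicator measurableSet_Ioi
  have hξi : ∀ t, IntegrableOn ξ (Ioc 0 t) := fun t =>
    integrableOn_Ioc_of_memLp (hξ.mono_measure Measure.restrict_le_self)
  have hconv : ∀ᵐ t : ℝ, ι (f t) = pastConvolution G B ξ t := by
    have hz' := (ae_restrict_iff' measurableSet_Ioi).1 hz
    filter_upwards [hz'] with t ht
    rcases le_or_gt t 0 with h | h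
    · rw [hf0 t h, map_zero, pastConvolution_of_nonpos G B hξ0 h]
    · rw [pastConvolution_eq_mildSolution G B hξ0 h.le, hf_def,
        indicator_of_mem (mem_Ioi.2 h), ht h, map_zero]
      refine mildSolution_congr G B h.le ?_
      filter_upwards [ae_restrict_mem measurableSet_Ioc] with s hs
      rw [hξ_def, indicator_of_mem (mem_Ioi.2 hs.1)]
  have heq : ∀ (p : ℂ), 0 < p.re → ∀ h : ℝ, 0 ≤ h → Complex.exp (p * h) • ι (laplace p f)
      = G.toFun h (ι (laplace p f))
        + ∫ r in (0 : ℝ)..h, Complex.exp (p * (h - r)) • G.toFun (max r 0) (B (laplace p ξ)) := by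
    intro p hp h hh
    have hfp := integrable_exp_smul hf0 hf hp
    have hae : (fun t : ℝ => ι (Complex.exp (-p * t) • f t))
        =ᵐ[volume] fun t : ℝ => Complex.exp (-p * t) • pastConvolution G B ξ t := by
      filter_upwards [hconv] with t ht
      rw [map_smul, ht]
    have e : ι (laplace p f) = laplace p (pastConvolution G B ξ) := by
      rw [laplace, ← ι.integral_comp_comm hfp, laplace]
      exact integral_congr_ae hae
    rw [e]
    exact laplace_pastConvolution G B hξ0 hξi hξm (integrable_exp_smul hξ0 hξ hp)
      ((ι.integrable_comp hfp).congr hae) hh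
  refine ⟨𝓕 (hf.toLp f), 𝓕 (hξ.toLp ξ), ?_, fun F => ?_⟩
  · let lam : ℕ → ℝ := fun n => 1 / ((n : ℝ) + 1)
    have hlam : ∀ n, 0 < lam n := fun n => by positivity
    have hlim : Tendsto lam atTop (𝓝 0) := tendsto_one_div_add_atTop_nhds_zero_nat
    obtain ⟨ns, hns, hV⟩ := exists_subseq_laplace_tendsto hf0 hf hlam hlim
    obtain ⟨ms, hms, hX⟩ := exists_subseq_laplace_tendsto hξ0 hξ (lam := fun n => lam (ns n))
      (fun n => hlam _) (hlim.comp hns.tendsto_atTop)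
    filter_upwards [hV, hX] with x hVx hXx
    refine exists_mem_domain_of_integral_eq G hA fun h hh => ?_
    have hl : Tendsto (fun k => lam (ns (ms k))) atTop (𝓝 0) :=
      hlim.comp (hns.tendsto_atTop.comp hms.tendsto_atTop)
    have hV' := hVx.comp hms.tendsto_atTop
    have hp : Tendsto (fun k => (lam (ns (ms k)) : ℂ) + Complex.I * (2 * Real.pi * x : ℝ)) atTop
        (𝓝 (Complex.I * (2 * Real.pi * x : ℝ))) := by
      have := ((Complex.continuous_ofReal.tendsto 0).comp hl).add_const
        (Complex.I * (2 * Real.pi * x : ℝ))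
      simpa using this
    -- Both sides of the equation depend continuously on `p` and on the Laplace transforms.
    have hL : Continuous fun q : ℂ × Hα => Complex.exp (q.1 * h) • ι q.2 := by fun_prop
    have hR : Continuous fun q : ℂ × Ξ =>
        ∫ r in (0 : ℝ)..h, Complex.exp (q.1 * (h - r)) • G.toFun (max r 0) (B q.2) := by
      refine intervalIntegral.continuous_parametric_intervalIntegral_of_continuous' ?_ 0 h
      have h1 : Continuous fun s : (ℂ × Ξ) × ℝ => G.toFun (max s.2 0) (B s.1.2) :=
        G.continuous_uncurry.comp (continuous_snd.prodMk (by fun_prop))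
      exact (by fun_prop : Continuous fun s : (ℂ × Ξ) × ℝ =>
        Complex.exp (s.1.1 * (h - s.2))).smul h1
    have h1 := (hL.tendsto _).comp (hp.prodMk_nhds hV')
    have h2 := ((((G.toFun h).comp ι).continuous.tendsto _).comp hV').add
      ((hR.tendsto _).comp (hp.prodMk_nhds hXx))
    refine tendsto_nhds_unique h1 (h2.congr fun k => ?_)
    exact (heq _ (by simpa using hlam _) h hh).symm
  · have e1 : F.cost z = ∫ t, F.form (f t) (ξ t) := by
      have h0 : (fun t => F.form (f t) (ξ t))
          = (Ioi (0 : ℝ)).indicator fun t => F.form (z.fst t) (z.snd t) := by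
        ext t
        by_cases ht : t ∈ Ioi (0 : ℝ)
        · simp only [hf_def, hξ_def, indicator_of_mem ht]
        · simp [hf_def, hξ_def, indicator_of_notMem ht, FormData.form]
      rw [h0, integral_indicator measurableSet_Ioi]
      rfl
    have e2 : F.cost z = ∫ t, F.form (hf.toLp f t) (hξ.toLp ξ t) := by
      rw [e1]
      refine integral_congr_ae ?_
      filter_upwards [hf.coeFn_toLp, hξ.coeFn_toLp] with t h1 h2
      rw [h1, h2]
    rw [e2, F.integral_form, F.integral_form, ← fourier_compLp, ← fourier_compLp,
      ← fourier_compLp, Lp.inner_fourier_eq, Lp.inner_fourier_eq, Lp.inner_fourier_eq]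

end Frequency

/-! ### Positivity of the three infima -/

section Alphas

theorem exists_real_of_zero_lt {a : EReal} (ha : 0 < a) : ∃ c : ℝ, 0 < c ∧ (c : EReal) ≤ a := by
  obtain ⟨c, hc0, hc⟩ := EReal.lt_iff_exists_real_btwn.1 ha
  exact ⟨c, by exact_mod_cast hc0, hc.le⟩

variable {H Hα Ξ : Type*}
  [NormedAddCommGroup H] [InnerProductSpace ℂ H]
  [NormedAddCommGroup Hα] [InnerProductSpace ℂ Hα]
  [NormedAddCommGroup Ξ] [InnerProductSpace ℂ Ξ]
  {G : C0Semigroup H} {A : H →ₗ.[ℂ] H} {B : Ξ →L[ℂ] H} {ι : Hα →L[ℂ] H}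

/-- Outside the spectrum the frequency domain equation is solved by the resolvent. -/
theorem frequency_equation_iff (hι_inj : Function.Injective ι)
    (hι_dom : ∀ x ∈ A.domain, x ∈ range ι) {μ : ℂ} (hμ : μ ∉ opSpectrum A) (v : Hα) (ξ : Ξ) :
    (∃ h : ι v ∈ A.domain, μ • ι v = A ⟨ι v, h⟩ + B ξ) ↔ v = -resolventIn A ι μ (B ξ) := by
  have hex : ∃ R : H →L[ℂ] H, IsResolventAt A μ R := not_not.1 hμ
  have hR : IsResolventAt A μ (opResolvent A μ) := by
    rw [opResolvent, dif_pos hex]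
    exact hex.choose_spec
  obtain ⟨hRd, hRA⟩ := hR.2 (B ξ)
  have hιr : ι (resolventIn A ι μ (B ξ)) = opResolvent A μ (B ξ) :=
    Function.invFun_eq (hι_dom _ hRd)
  constructor
  · rintro ⟨h, he⟩
    apply hι_inj
    have h1 := hR.1 ⟨ι v, h⟩
    have h2 : A ⟨ι v, h⟩ - μ • ι v = -B ξ := by rw [he]; abel
    simp only at h1
    rw [h2, map_neg] at h1
    rw [map_neg, hιr, h1]
  · rintro rfl
    have hd : ι (-resolventIn A ι μ (B ξ)) ∈ A.domain := by
      rw [map_neg, hιr]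
      exact A.domain.neg_mem hRd
    refine ⟨hd, ?_⟩
    have h3 : (⟨ι (-resolventIn A ι μ (B ξ)), hd⟩ : A.domain)
        = -⟨opResolvent A μ (B ξ), hRd⟩ := by
      ext
      simp [hιr]
    rw [h3, LinearPMap.map_neg, map_neg, hιr, smul_neg]
    nth_rewrite 3 [← hRA]
    abel

variable [CompleteSpace Hα] [CompleteSpace Ξ] {F : FormData Hα Ξ}

theorem FormData.form_zero : F.form 0 0 = 0 := by simp [FormData.form]

theorem FormData.cost_zero : F.cost 0 = 0 := by simp [F.cost_eq]

theorem zero_lt_alpha₁_iff : 0 < alpha₁ G B ι F ↔ ∃ c : ℝ, 0 < c ∧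
    ∀ z ∈ processes G B ι 0, c * (‖z.fst‖ ^ 2 + ‖z.snd‖ ^ 2) ≤ F.cost z := by
  constructor
  · intro h
    obtain ⟨c, hc, hca⟩ := exists_real_of_zero_lt h
    refine ⟨c, hc, fun z hz => ?_⟩
    by_cases hz0 : z = 0
    · simp [hz0, FormData.cost_zero]
    · have h1 : 0 < ‖z.fst‖ ^ 2 + ‖z.snd‖ ^ 2 := by
        rw [← WithLp.prod_norm_sq_eq_of_L2]
        exact pow_pos (norm_pos_iff.2 hz0) 2
      have h2 := hca.trans (iInf_le_of_le z (iInf_le_of_le hz (iInf_le _ hz0)))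
      rw [EReal.coe_le_coe_iff, le_div_iff₀ h1] at h2
      exact h2
  · rintro ⟨c, hc, h⟩
    refine lt_of_lt_of_le (EReal.coe_pos.2 hc) (le_iInf fun z => le_iInf fun hz => le_iInf
      fun hz0 => ?_)
    have h1 : 0 < ‖z.fst‖ ^ 2 + ‖z.snd‖ ^ 2 := by
      rw [← WithLp.prod_norm_sq_eq_of_L2]
      exact pow_pos (norm_pos_iff.2 hz0) 2
    rw [EReal.coe_le_coe_iff, le_div_iff₀ h1]
    exact h z hz

theorem zero_lt_alpha₂_iff : 0 < alpha₂ A B ι F ↔ ∃ c : ℝ, 0 < c ∧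
    ∀ (ω : ℝ) (v : Hα) (ξ : Ξ),
      (∃ h : ι v ∈ A.domain, (Complex.I * ω) • ι v = A ⟨ι v, h⟩ + B ξ) →
      c * (‖v‖ ^ 2 + ‖ξ‖ ^ 2) ≤ F.form v ξ := by
  have hpos : ∀ (v : Hα) (ξ : Ξ), (v, ξ) ≠ 0 → 0 < ‖v‖ ^ 2 + ‖ξ‖ ^ 2 := fun v ξ h => by
    by_cases hv : v = 0
    · have hξ : ξ ≠ 0 := fun hξ => h (by rw [hv, hξ]; rfl)
      have := pow_pos (norm_pos_iff.2 hξ) 2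
      positivity
    · have := pow_pos (norm_pos_iff.2 hv) 2
      positivity
  constructor
  · intro h
    obtain ⟨c, hc, hca⟩ := exists_real_of_zero_lt h
    refine ⟨c, hc, fun ω v ξ hv => ?_⟩
    by_cases h0 : (v, ξ) = 0
    · obtain ⟨rfl, rfl⟩ := Prod.mk_eq_zero.1 h0
      simp [FormData.form_zero]
    · have h2 := hca.trans (iInf_le_of_le ω (iInf_le_of_le v (iInf_le_of_le ξ
        (iInf_le_of_le hv (iInf_le _ h0)))))
      rw [EReal.coe_le_coe_iff, le_div_iff₀ (hpos v ξ h0)] at h2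
      exact h2
  · rintro ⟨c, hc, h⟩
    refine lt_of_lt_of_le (EReal.coe_pos.2 hc) (le_iInf fun ω => le_iInf fun v => le_iInf
      fun ξ => le_iInf fun hv => le_iInf fun h0 => ?_)
    rw [EReal.coe_le_coe_iff, le_div_iff₀ (hpos v ξ h0)]
    exact h ω v ξ hv

theorem zero_lt_alpha₃_iff : 0 < alpha₃ A B ι F ↔ ∃ c : ℝ, 0 < c ∧
    ∀ (ω : ℝ) (ξ : Ξ), ξ ≠ 0 →
      c * ‖ξ‖ ^ 2 ≤ F.form (-resolventIn A ι (Complex.I * ω) (B ξ)) ξ := by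
  constructor
  · intro h
    obtain ⟨c, hc, hca⟩ := exists_real_of_zero_lt h
    refine ⟨c, hc, fun ω ξ h0 => ?_⟩
    have h2 := hca.trans (iInf_le_of_le ω (iInf_le_of_le ξ (iInf_le _ h0)))
    rw [EReal.coe_le_coe_iff, le_div_iff₀ (pow_pos (norm_pos_iff.2 h0) 2)] at h2
    exact h2
  · rintro ⟨c, hc, h⟩
    refine lt_of_lt_of_le (EReal.coe_pos.2 hc) (le_iInf fun ω => le_iInf fun ξ => le_iInf
      fun h0 => ?_)
    rw [EReal.coe_le_coe_iff, le_div_iff₀ (pow_pos (norm_pos_iff.2 h0) 2)]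
    exact h ω ξ h0

theorem zero_lt_alpha₂_iff_alpha₃ (hι_inj : Function.Injective ι)
    (hι_dom : ∀ x ∈ A.domain, x ∈ range ι) (hw : Alpha₃WellDefined A B ι) :
    0 < alpha₂ A B ι F ↔ 0 < alpha₃ A B ι F := by
  obtain ⟨hspec, C, hC⟩ := hw
  rw [zero_lt_alpha₂_iff, zero_lt_alpha₃_iff]
  constructor
  · rintro ⟨c, hc, h⟩
    refine ⟨c, hc, fun ω ξ _ => ?_⟩
    refine le_trans ?_ (h ω _ ξ ((frequency_equation_iff hι_inj hι_dom (hspec ω) _ ξ).2 rfl))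
    nlinarith [sq_nonneg ‖-resolventIn A ι (Complex.I * ω) (B ξ)‖]
  · rintro ⟨c, hc, h⟩
    refine ⟨c / (C ^ 2 + 1), by positivity, fun ω v ξ hv => ?_⟩
    obtain rfl := (frequency_equation_iff hι_inj hι_dom (hspec ω) v ξ).1 hv
    have h1 := hC ω ξ
    have h2 : ‖-resolventIn A ι (Complex.I * ω) (B ξ)‖ ^ 2 ≤ C ^ 2 * ‖ξ‖ ^ 2 := by
      rw [norm_neg, ← mul_pow]
      exact pow_le_pow_left₀ (norm_nonneg _) h1 2
    by_cases hξ : ξ = 0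
    · subst hξ
      have h4 : resolventIn A ι (Complex.I * ω) (B 0) = 0 := by
        rw [norm_zero, mul_zero] at h1
        exact norm_le_zero_iff.1 h1
      rw [h4]
      simp [FormData.form_zero]
    · calc c / (C ^ 2 + 1) * (‖-resolventIn A ι (Complex.I * ω) (B ξ)‖ ^ 2 + ‖ξ‖ ^ 2)
          ≤ c / (C ^ 2 + 1) * (C ^ 2 * ‖ξ‖ ^ 2 + ‖ξ‖ ^ 2) := by gcongr
        _ = c * ‖ξ‖ ^ 2 := by field_simp
        _ ≤ _ := h ω ξ hξ

variable [CompleteSpace H]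

/-- The frequency condition follows from the time domain condition: the form decreased by
`c (|v|² + |ξ|²)` still has an optimal cost. Along the periodic process `e^{i ω t} (v, ξ)` this cost
takes the same value at times `0` and `1`, so that the dissipation inequality makes the form
nonnegative at `(v, ξ)`. -/
theorem zero_lt_alpha₂_of_alpha₁ (hA : IsGenerator A G) (hCONT : L2Controllable G B ι)
    (h : 0 < alpha₁ G B ι F) : 0 < alpha₂ A B ι F := by
  obtain ⟨c, hc, hF⟩ := zero_lt_alpha₁_iff.1 h
  refine zero_lt_alpha₂_iff.2 ⟨c / 2, by positivity, fun ω v ξ hv => ?_⟩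
  obtain ⟨hdom, hv⟩ := hv
  obtain ⟨S, hS⟩ := exists_optimal_clm hCONT (F := F.shift (c / 2)) (c := c / 2) (by positivity)
    (fun z hz => by
      have := hF z hz
      rw [F.shift_cost]
      linarith)
  have hopt : ∀ v₀, IsOptimalProcess G B ι (F.shift (c / 2)) v₀ (S v₀) := fun v₀ =>
    (isOptimalProcess_iff_eq (by positivity) (hS v₀).1 (hS v₀).2 _).2 rfl
  obtain ⟨P, -, hP⟩ := exists_cost_operator (F.shift (c / 2)) S
  have hnorm : ∀ t : ℝ, (starRingEnd ℂ) (Complex.exp (Complex.I * ω * t))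
      * Complex.exp (Complex.I * ω * t) = 1 := fun t => by
    rw [← Complex.exp_conj, ← Complex.exp_add]
    simp
  have hd := dissipation_inequality hopt (T := 1) zero_le_one (v₀ := v)
    (ξ := fun t => Complex.exp (Complex.I * ω * t) • ξ)
    (v := fun t => Complex.exp (Complex.I * ω * t) • v)
    (memLp_of_continuousOn_Icc (by fun_prop)) (by fun_prop) (fun t ht => by
      rw [map_smul, mildSolution_periodic hA ⟨ι v, hdom⟩ hv ht.1])
  -- `|e^{i ω}| = 1` and the optimal cost is a Hermitian form.
  have hcost : (F.shift (c / 2)).cost (S (Complex.exp (Complex.I * ω * (1 : ℝ)) • v))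
      = (F.shift (c / 2)).cost (S v) := by
    have h1 := hP (Complex.exp (Complex.I * ω * (1 : ℝ)) • v)
    rw [map_smul, inner_smul_left, inner_smul_right, ← mul_assoc, hnorm, one_mul, hP] at h1
    exact_mod_cast h1.symm
  have hform : ∀ t : ℝ, (F.shift (c / 2)).form (Complex.exp (Complex.I * ω * t) • v)
      (Complex.exp (Complex.I * ω * t) • ξ) = (F.shift (c / 2)).form v ξ := fun t => by
    simp only [FormData.form, map_smul, inner_smul_left, inner_smul_right, ← mul_assoc,
      (mul_comm _ _).trans (hnorm t), one_mul]
  simp only [hcost, hform, sub_self, zero_add, intervalIntegral.integral_const, sub_zero,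
    one_smul, F.shift_form] at hd
  linarith

/-- The time domain condition follows from the frequency condition by Plancherel's theorem. -/
theorem zero_lt_alpha₁_of_alpha₂ (hA : IsGenerator A G) (h : 0 < alpha₂ A B ι F) :
    0 < alpha₁ G B ι F := by
  obtain ⟨c, hc, hF⟩ := zero_lt_alpha₂_iff.1 h
  refine zero_lt_alpha₁_iff.2 ⟨c, hc, fun z hz => ?_⟩
  obtain ⟨v, ξ, hvξ, hcost⟩ := exists_frequency_representation hA hz
  have h1 : 0 ≤ (F.shift c).cost z := by
    rw [hcost]
    refine integral_nonneg_of_ae ?_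
    filter_upwards [hvξ] with x hx
    have := hF _ _ _ hx
    rw [Pi.zero_apply, F.shift_form]
    linarith
  rw [F.shift_cost] at h1
  linarith

end Alphas

end FreqThm

end

theorem mainTheorem2
    {H Hα Ξ : Type*}
    [NormedAddCommGroup H] [InnerProductSpace ℂ H] [CompleteSpace H]
    [NormedAddCommGroup Hα] [InnerProductSpace ℂ Hα] [CompleteSpace Hα]
    [NormedAddCommGroup Ξ] [InnerProductSpace ℂ Ξ] [CompleteSpace Ξ]
    (G : FreqThm.C0Semigroup H) (A : H →ₗ.[ℂ] H) (hA : FreqThm.IsGenerator A G)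
    (B : Ξ →L[ℂ] H)
    (ι : Hα →L[ℂ] H) (hι_inj : Function.Injective ι) (hι_dense : DenseRange ι)
    (hι_dom : ∀ x ∈ A.domain, x ∈ Set.range ι)
    (F : FreqThm.FormData Hα Ξ)
    (hCONT : FreqThm.L2Controllable G B ι) :
    (0 < FreqThm.alpha₁ G B ι F →
      (∀ v₀ : Hα, ∃! z : FreqThm.ProcessSpace Hα Ξ, FreqThm.IsOptimalProcess G B ι F v₀ z) ∧
      ∃ S : Hα →L[ℂ] FreqThm.ProcessSpace Hα Ξ,
        (∀ v₀ : Hα, FreqThm.IsOptimalProcess G B ι F v₀ (S v₀)) ∧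
        ∃ P : Hα →L[ℂ] Hα, IsSelfAdjoint P ∧
          (∀ v₀ : Hα, inner ℂ (P v₀) v₀ = (F.cost (S v₀) : ℂ)) ∧
          ∀ (T : ℝ), 0 ≤ T → ∀ (v₀ : Hα) (ξ : ℝ → Ξ) (v : ℝ → Hα),
            MemLp ξ 2 (volume.restrict (Set.Ioc 0 T)) →
            ContinuousOn v (Set.Icc 0 T) →
            (∀ t ∈ Set.Icc 0 T, ι (v t) = FreqThm.mildSolution G B (ι v₀) ξ t) →
            0 ≤ (inner ℂ (P (v T)) (v T)).re - (inner ℂ (P v₀) v₀).re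
              + ∫ t in (0 : ℝ)..T, F.form (v t) (ξ t)) ∧
    (0 < FreqThm.alpha₁ G B ι F ↔ 0 < FreqThm.alpha₂ A B ι F) ∧
    (FreqThm.Alpha₃WellDefined A B ι →
      (0 < FreqThm.alpha₂ A B ι F ↔ 0 < FreqThm.alpha₃ A B ι F)) := by
  refine ⟨fun h₁ => ?_, ⟨FreqThm.zero_lt_alpha₂_of_alpha₁ hA hCONT,
    FreqThm.zero_lt_alpha₁_of_alpha₂ hA⟩, FreqThm.zero_lt_alpha₂_iff_alpha₃ hι_inj hι_dom⟩
  obtain ⟨c, hc, hF⟩ := FreqThm.zero_lt_alpha₁_iff.1 h₁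
  obtain ⟨S, hS⟩ := FreqThm.exists_optimal_clm hCONT hc hF
  have hiff := fun v₀ => FreqThm.isOptimalProcess_iff_eq hc (hS v₀).1 (hS v₀).2
  have hopt : ∀ v₀, FreqThm.IsOptimalProcess G B ι F v₀ (S v₀) := fun v₀ => (hiff v₀ _).2 rfl
  obtain ⟨P, hP, hPS⟩ := FreqThm.exists_cost_operator F S
  have hre : ∀ v₀, (inner ℂ (P v₀) v₀).re = F.cost (S v₀) := fun v₀ => by
    rw [hPS, Complex.ofReal_re]
  refine ⟨fun v₀ => ⟨S v₀, hopt v₀, fun z hz => (hiff v₀ z).1 hz⟩, S, hopt, P, hP, hPS, ?_⟩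
  intro T hT v₀ ξ v hξ hv hm
  rw [hre, hre]
  exact FreqThm.dissipation_inequality hopt hT hξ hv hm
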